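/- Let $A\ge 0$ be a (possibly unbounded) self-adjoint operator on a complex Hilbert space $H$ with form domain $Q(A)=\mathrm{dom}\,\sqrt A$, and let $B$ be a hermitian sesquilinear form on $Q(A)$, written $\langle\varphi|B\psi\rangle$, such that for some $a\ge 0$ and $0<\lambda<1$ $$|\langle\psi|B\psi\rangle|\le\lambda\left(\|\sqrt A\,\psi\|^2+a\|\psi\|^2\right)\qquad\text{for all }\psi\in Q(A).$$ Let $A+B$ denote the operator associated with the form sum, i.e. $(A+B)\varphi=\eta$ if and only if $\varphi\in Q(A)$ and $\langle\sqrt A\psi|\sqrt A\varphi\rangle+\langle\psi|B\varphi\rangle=\langle\psi|\eta\rangle$ for all $\psi\in Q(A)$. Write $A_a=A+a$. Then: (i) $A+B$ is self-adjoint and $A+B+a\ge 0$. (ii) There is a bounded self-adjoint operator $C$ with $\|C\|\le\lambda<1$ and $B=\sqrt{A_a}\,C\sqrt{A_a}$, in the sense that $\langle\varphi|B\psi\rangle=\langle\sqrt{A_a}\varphi|C\sqrt{A_a}\psi\rangle$ for all $\varphi,\psi\in Q(A)$. (iii) Let $C$ be any bounded operator with $\|C\|<1$ and $B=\sqrt{A_a}\,C\sqrt{A_a}$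 in this sense. For $t,\gamma,\kappa>0$ and $n\ge1$ put $$D_n=\frac1{2\pi \mathrm i}\int_{\Gamma_{\gamma,\kappa}} e^{-tz}\,\frac{A_a^{1/2}}{z-A_a}\left(C\,\frac{A_a}{z-A_a}\right)^{n-1}C\,\frac{A_a^{1/2}}{z-A_a}\,dz,$$ where $\Gamma_{\gamma,\kappa}=\{z\in\mathbb C:\ \mathrm{Re}\,z=-\kappa+\gamma|\mathrm{Im}\,z|\}$ is traversed from top to bottom. The integral converges absolutely in operator norm, $D_n$ does not depend on $\gamma$ and $\kappa$, and, for all $n\ge 1$ and all $t>0$, $$\|D_n\|\le\frac{e^{3/2}}{\pi}\sqrt{n+2}\,\|C\|^n .$$ Hence $\sum_{n\ge1}\|D_n\|<\infty$. Moreover, with series converging in operator norm, $$e^{-t(A+B+a)}=e^{-t(A+a)}+\sum_{n\ge1}D_n,\qquad\text{equivalently}\qquad e^{-t(A+B)}=e^{-tA}+\sum_{n\ge1}e^{ta}D_n .$$ In particular, for $a=0$, $e^{-t(A+B)}=e^{-tA}+\sum_{n\ge1}D_n$. -/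

import Mathlib

open scoped InnerProductSpace

namespace FormDyson

noncomputable section

variable {H : Type*} [NormedAddCommGroup H] [InnerProductSpace ℂ H]

/-- `R` is a bounded two-sided inverse of `z - T`. -/
def IsResolventAt (T : H →ₗ.[ℂ] H) (z : ℂ) (R : H →L[ℂ] H) : Prop :=
  (∀ y : H, ∃ h : R y ∈ T.domain, z • R y - T ⟨R y, h⟩ = y) ∧
    ∀ x : T.domain, R (z • (x : H) - T x) = x

open Classical in
/-- The resolvent `(z - T)⁻¹` of an unbounded operator (zero if `z` is in the spectrum of `T`).
A bounded two-sided inverse is unique when it exists. -/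
def resolventOp (T : H →ₗ.[ℂ] H) (z : ℂ) : H →L[ℂ] H :=
  if h : ∃ R : H →L[ℂ] H, IsResolventAt T z R then h.choose else 0

/-- `K` is the everywhere defined bounded operator `S R`, the product of an unbounded operator
`S` and a bounded operator `R` that maps into the domain of `S`. -/
def IsBoundedProduct (S : H →ₗ.[ℂ] H) (R K : H →L[ℂ] H) : Prop :=
  ∀ x : H, ∃ h : R x ∈ S.domain, S ⟨R x, h⟩ = K x

open Classical in
/-- The bounded operator `S R` (zero if `S R` is not everywhere defined and bounded). -/
def boundedProduct (S : H →ₗ.[ℂ] H) (R : H →L[ℂ] H) : H →L[ℂ] H :=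
  if h : ∃ K : H →L[ℂ] H, IsBoundedProduct S R K then h.choose else 0

/-- The operator `A + a` for a real number `a`, on the domain of `A`. -/
def addConst (A : H →ₗ.[ℂ] H) (a : ℝ) : H →ₗ.[ℂ] H :=
  ((a : ℂ) • (LinearMap.id : H →ₗ[ℂ] H)) +ᵥ A

/-- `T ≥ 0` in the sense of quadratic forms on the domain of `T`. -/
def IsNonneg (T : H →ₗ.[ℂ] H) : Prop :=
  ∀ x : T.domain, 0 ≤ (⟪(x : H), T x⟫_ℂ).re

section Complete

variable [CompleteSpace H]

/-- The functional calculus `f(T)` of a self-adjoint operator `T`, for functions `f` that are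
continuous on the spectrum of `T` and vanish at infinity along it. It is obtained from the
continuous functional calculus of the bounded normal operator `(T + i)⁻¹ = -(-i - T)⁻¹`:
a spectral value `s` of `T` corresponds to the spectral value `w = (s + i)⁻¹` of `(T + i)⁻¹`,
so that `s = w⁻¹ - i`, and `w = 0` corresponds to infinity. -/
def funcCalc (T : H →ₗ.[ℂ] H) (f : ℝ → ℂ) : H →L[ℂ] H :=
  cfc (fun w : ℂ => if w = 0 then 0 else f (w⁻¹ - Complex.I).re) (-(resolventOp T (-Complex.I)))

/-- The heat operator `e^{-tT}` of a self-adjoint operator `T` bounded from below, `t > 0`. -/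
def heat (T : H →ₗ.[ℂ] H) (t : ℝ) : H →L[ℂ] H :=
  funcCalc T fun s => Complex.exp (-((t * s : ℝ) : ℂ))

/-- The square root `√A` of a self-adjoint operator `A ≥ 0`, given through its resolvent
`G = (1 + √A)⁻¹`, which is the function `(1 + √s)⁻¹` of `A`: the domain of `√A` is the range
of `G`, and `√A (G y) = y - G y`. -/
def sqrtOp (A : H →ₗ.[ℂ] H) : H →ₗ.[ℂ] H :=
  let G : H →L[ℂ] H := funcCalc A fun s => (((1 + √s)⁻¹ : ℝ) : ℂ)
  (LinearMap.range
    ((G : H →ₗ[ℂ] H).prod ((1 - G : H →L[ℂ] H) : H →ₗ[ℂ] H))).toLinearPMap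

/-- The quadratic form domain of a self-adjoint operator `A ≥ 0`, the domain of `√A`. -/
abbrev formDomain (A : H →ₗ.[ℂ] H) : Submodule ℂ H := (sqrtOp A).domain

/-- The sesquilinear form `⟨φ|Aψ⟩ := ⟨√A φ|√A ψ⟩` on the form domain of `A`. -/
def energyForm (A : H →ₗ.[ℂ] H) (φ ψ : formDomain A) : ℂ :=
  ⟪sqrtOp A φ, sqrtOp A ψ⟫_ℂ

/-- The graph of the operator associated with the form `A + B`: the pairs `(φ, η)` with `φ` in
the form domain of `A` and `⟨ψ|Aφ⟩ + B(ψ, φ) = ⟨ψ|η⟩` for all `ψ` in the form domain. -/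
def formSumGraph (A : H →ₗ.[ℂ] H) (B : formDomain A →ₗ⋆[ℂ] formDomain A →ₗ[ℂ] ℂ) :
    Submodule ℂ (H × H) where
  carrier := {p | ∃ h : p.1 ∈ formDomain A, ∀ ψ : formDomain A,
    energyForm A ψ ⟨p.1, h⟩ + B ψ ⟨p.1, h⟩ = ⟪(ψ : H), p.2⟫_ℂ}
  add_mem' := by
    rintro ⟨x, u⟩ ⟨y, v⟩ ⟨hx, hu⟩ ⟨hy, hv⟩
    refine ⟨Submodule.add_mem _ hx hy, fun ψ => ?_⟩
    have e : (⟨x + y, Submodule.add_mem _ hx hy⟩ : formDomain A) = ⟨x, hx⟩ + ⟨y, hy⟩ := rfl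
    have h1 := hu ψ
    have h2 := hv ψ
    simp only [energyForm] at h1 h2 ⊢
    simp only [Prod.mk_add_mk, e, map_add, LinearPMap.map_add, inner_add_right]
    rw [← h1, ← h2]
    ring
  zero_mem' := by
    refine ⟨Submodule.zero_mem _, fun ψ => ?_⟩
    have e : (⟨0, Submodule.zero_mem _⟩ : formDomain A) = 0 := rfl
    simp [energyForm, e]
  smul_mem' := by
    rintro c ⟨x, u⟩ ⟨hx, hu⟩
    refine ⟨Submodule.smul_mem _ c hx, fun ψ => ?_⟩
    have e : (⟨c • x, Submodule.smul_mem _ c hx⟩ : formDomain A) = c • ⟨x, hx⟩ := rfl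
    have h1 := hu ψ
    simp only [energyForm] at h1 ⊢
    simp only [Prod.smul_mk, e, map_smul, LinearPMap.map_smul, inner_smul_right, smul_eq_mul]
    rw [← h1]
    ring

/-- The operator `A + B`, defined as a form sum. -/
def formSum (A : H →ₗ.[ℂ] H) (B : formDomain A →ₗ⋆[ℂ] formDomain A →ₗ[ℂ] ℂ) : H →ₗ.[ℂ] H :=
  (formSumGraph A B).toLinearPMap

/-- The bounded operator `C` represents the form `B` on the form domain of `A` as
`B = √(A + a) C √(A + a)`. -/
def Represents (A : H →ₗ.[ℂ] H) (a : ℝ) (B : formDomain A →ₗ⋆[ℂ] formDomain A →ₗ[ℂ] ℂ)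
    (C : H →L[ℂ] H) : Prop :=
  ∀ φ ψ : formDomain A, ∃ (hφ : (φ : H) ∈ formDomain (addConst A a))
    (hψ : (ψ : H) ∈ formDomain (addConst A a)),
    B φ ψ = ⟪sqrtOp (addConst A a) ⟨φ, hφ⟩, C (sqrtOp (addConst A a) ⟨ψ, hψ⟩)⟫_ℂ

/-- The contour `{z | Re z = -κ + γ |Im z|}`, parametrized from top to bottom by `u = -Im z`. -/
def contour (γ κ u : ℝ) : ℂ := ((-κ + γ * |u| : ℝ) : ℂ) - u * Complex.I

/-- The derivative (for `u ≠ 0`) of the parametrization of the contour. -/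
def contourDeriv (γ u : ℝ) : ℂ := ((γ * Real.sign u : ℝ) : ℂ) - Complex.I

/-- `e^{-tz} (√A / (z - A)) (C A / (z - A))ⁿ⁻¹ C (√A / (z - A))`. -/
def dysonIntegrand (A : H →ₗ.[ℂ] H) (C : H →L[ℂ] H) (t : ℝ) (n : ℕ) (z : ℂ) : H →L[ℂ] H :=
  Complex.exp (-(t * z)) •
    (boundedProduct (sqrtOp A) (resolventOp A z) *
      (C * boundedProduct A (resolventOp A z)) ^ (n - 1) * C *
      boundedProduct (sqrtOp A) (resolventOp A z))

/-- The Dyson integrand pulled back to the real line along the contour. -/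
def dysonPullback (A : H →ₗ.[ℂ] H) (C : H →L[ℂ] H) (t γ κ : ℝ) (n : ℕ) (u : ℝ) : H →L[ℂ] H :=
  contourDeriv γ u • dysonIntegrand A C t n (contour γ κ u)

/-- The `n`-th term `D_n` of the Dyson expansion, `n ≥ 1`, as a contour integral. -/
def dysonTerm (A : H →ₗ.[ℂ] H) (C : H →L[ℂ] H) (t γ κ : ℝ) (n : ℕ) : H →L[ℂ] H :=
  (2 * (Real.pi : ℂ) * Complex.I)⁻¹ • ∫ u : ℝ, dysonPullback A C t γ κ n u

end Complete

end

end FormDyson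

/-!
All operators are handled through bounded ones. For a self-adjoint operator `T ≥ b` the continuous
functional calculus of the bounded normal operator `(T + i)⁻¹` is extended to functions on
`[b, ∞)` that have a limit at infinity (`opFun`). It is multiplicative, and
`T g(T) = (s ↦ s g(s))(T)`, `√T g(T) = (s ↦ √s g(s))(T)`, so that resolvents, square roots and heat
operators can be compared and bounded by looking at functions of a real variable. In particular
`A` and `A + a` have the same form domain, and `‖√(A + a) φ‖² = ‖√A φ‖² + a ‖φ‖²`.

Put `T = A + a`. In the variables `x = (1 + √T) φ` the hypothesis on `B` says that a hermitian form
on `H` is bounded on the diagonal by `λ ‖K x‖²` with the bounded operator `K = √T (1 + √T)⁻¹`. By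
polarization it is bounded by `λ ‖K x‖ ‖K y‖`, hence it is of the form `⟨K x|C K y⟩` with
`‖C‖ ≤ λ` (`exists_isSelfAdjoint_factor`), which is the representation `B = √T C √T`.

The form sum `K` is then the operator of the form `⟨√T φ|(1 + C) √T ψ⟩` (`IsFormOp`). With
`P = (z - T)⁻¹`, `Q = √T P` and `Z = T P`, the vector `P y + Q (1 - C Z)⁻¹ C Q y` solves
`(z - K) φ = y` whenever `1 - C Z` has a right inverse (`formGraph_resolvent`). At `z = -1` one has
`‖Z‖ ≤ 1`, so `z - K` is onto and the symmetric operator `K ≥ 0` is self-adjoint. On the contour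
with parameters `γ`, `κ` one has `‖Z‖ ≤ √(1 + γ²)`, so for small `γ` the inverse is a Neumann
series, and the resolvent of `K` is the sum of the resolvent of `T` and the integrands of the Dyson
terms (without the exponential). Integrating against `e^{-tz}` and using
`e^{-tT} = (2πi)⁻¹ ∫ e^{-tz} (z - T)⁻¹ dz` for `T` and for `K` (`SelfAdjointGE.heat_eq`) gives the
expansion for small `γ`.

The integrands are holomorphic on the plane cut along `[0, ∞)`, which is biholomorphic to a convex
strip, and so they have primitives there. This makes the contour integrals independent of the
contour (`integral_contour_eq`), which extends the expansion to all `γ` and `κ`, and allows the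
terms to be estimated on the contour with `κ = 1 / t` and `γ = 1 / √(n + 2)`
(`norm_dysonTerm_le`). The expansion for `A` itself follows from
`e^{-tA} = e^{ta} e^{-t(A + a)}`.
-/

namespace FormDyson

open Filter Topology

noncomputable section

section Operators

variable {H : Type*} [NormedAddCommGroup H] [InnerProductSpace ℂ H]

/-! ### Resolvents of self-adjoint operators -/

lemma inner_self_eq_ofReal (x : H) : ⟪x, x⟫_ℂ = ((‖x‖ ^ 2 : ℝ) : ℂ) := by
  rw [inner_self_eq_norm_sq_to_K]; simp

section Resolvent

variable {T : H →ₗ.[ℂ] H} {z w : ℂ} {R S : H →L[ℂ] H}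

lemma IsResolventAt.apply_mem (h : IsResolventAt T z R) (y : H) : R y ∈ T.domain := (h.1 y).1

lemma IsResolventAt.map_apply (h : IsResolventAt T z R) (y : H) (hy : R y ∈ T.domain) :
    T ⟨R y, hy⟩ = z • R y - y := by
  obtain ⟨_, e⟩ := h.1 y
  exact (sub_sub_cancel (z • R y) _).symm.trans (congrArg (z • R y - ·) e)

/-- A right inverse of `z - T` and a left inverse of `z - T` coincide. -/
lemma IsResolventAt.eq_of_right_inverse (h : IsResolventAt T z R)
    (hS : ∀ y : H, ∃ h : S y ∈ T.domain, z • S y - T ⟨S y, h⟩ = y) : S = R := by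
  ext y
  obtain ⟨hy, e⟩ := hS y
  have := h.2 ⟨S y, hy⟩
  rw [e] at this
  exact this.symm

lemma IsResolventAt.resolventOp_eq (h : IsResolventAt T z R) : resolventOp T z = R := by
  have hex : ∃ R : H →L[ℂ] H, IsResolventAt T z R := ⟨R, h⟩
  rw [resolventOp, dif_pos hex]
  exact h.eq_of_right_inverse hex.choose_spec.1

/-- The first resolvent identity. -/
lemma IsResolventAt.sub_eq (hR : IsResolventAt T z R) (hS : IsResolventAt T w S) :
    R - S = (w - z) • (R * S) := by
  ext y
  have h1 := hR.2 ⟨S y, hS.apply_mem y⟩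
  rw [hS.map_apply] at h1
  have h2 : z • S y - (w • S y - y) = y - (w - z) • S y := by module
  simp only [h2, map_sub, map_smul] at h1
  change R y - S y = (w - z) • R (S y)
  exact sub_eq_iff_comm.1 h1

lemma IsResolventAt.commute (hR : IsResolventAt T z R) (hS : IsResolventAt T w S) :
    Commute R S := by
  rcases eq_or_ne w z with rfl | hne
  · rw [hR.eq_of_right_inverse hS.1]
  · have h1 := hR.sub_eq hS
    have h2 := hS.sub_eq hR
    have h3 : (w - z) • (R * S) = (w - z) • (S * R) := by
      rw [← h1, ← neg_sub S R, h2, ← neg_smul]; congr 1; ring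
    exact smul_right_injective _ (sub_ne_zero.2 hne) h3

lemma IsResolventAt.injective (hR : IsResolventAt T z R) {y : H} (hy : R y = 0) : y = 0 := by
  obtain ⟨h, e⟩ := hR.1 y
  have : (⟨R y, h⟩ : T.domain) = 0 := Subtype.ext hy
  rw [this, hy] at e
  simpa using e.symm

lemma IsResolventAt.mem_range (hR : IsResolventAt T z R) (x : T.domain) : ∃ y, R y = x :=
  ⟨_, hR.2 x⟩

end Resolvent

section AddConst

variable {T : H →ₗ.[ℂ] H}

lemma addConst_apply (a : ℝ) (x : (addConst T a).domain) :
    addConst T a x = (a : ℂ) • (x : H) + T ⟨x, x.2⟩ := rfl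

lemma addConst_addConst_neg (a : ℝ) : addConst (addConst T a) (-a) = T := by
  refine LinearPMap.ext rfl fun x h1 h2 => ?_
  rw [addConst_apply, addConst_apply]
  simp

lemma isResolventAt_addConst {a : ℝ} {z : ℂ} {R : H →L[ℂ] H} :
    IsResolventAt (addConst T a) z R ↔ IsResolventAt T (z - a) R := by
  have key : ∀ (x : H) (h : x ∈ T.domain),
      z • x - addConst T a ⟨x, h⟩ = (z - a) • x - T ⟨x, h⟩ := by
    intro x h; rw [addConst_apply]; simp only; module
  constructor
  · rintro ⟨h1, h2⟩
    refine ⟨fun y => ?_, fun x => ?_⟩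
    · obtain ⟨h, e⟩ := h1 y
      exact ⟨h, (key _ h).symm.trans e⟩
    · rw [← key x x.2]; exact h2 x
  · rintro ⟨h1, h2⟩
    refine ⟨fun y => ?_, fun x => ?_⟩
    · obtain ⟨h, e⟩ := h1 y
      exact ⟨h, (key _ h).trans e⟩
    · rw [key x x.2]; exact h2 ⟨x, x.2⟩

lemma resolventOp_addConst (a : ℝ) (z : ℂ) :
    resolventOp (addConst T a) z = resolventOp T (z - a) := by
  by_cases h : ∃ R : H →L[ℂ] H, IsResolventAt T (z - a) R
  · obtain ⟨R, hR⟩ := h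
    rw [hR.resolventOp_eq, (isResolventAt_addConst.2 hR).resolventOp_eq]
  · have h' : ¬ ∃ R : H →L[ℂ] H, IsResolventAt (addConst T a) z R := by
      simpa only [isResolventAt_addConst] using h
    rw [resolventOp, resolventOp, dif_neg h, dif_neg h']

/-- `T ≥ b` in the sense of quadratic forms. -/
def LowerBound (T : H →ₗ.[ℂ] H) (b : ℝ) : Prop :=
  ∀ x : T.domain, b * ‖(x : H)‖ ^ 2 ≤ (⟪(x : H), T x⟫_ℂ).re

lemma LowerBound.addConst {b : ℝ} (hb : LowerBound T b) (a : ℝ) :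
    LowerBound (addConst T a) (b + a) := by
  intro x
  have := hb ⟨x, x.2⟩
  rw [addConst_apply, inner_add_right, inner_smul_right, inner_self_eq_ofReal]
  simp only [Complex.add_re, ← Complex.ofReal_mul, Complex.ofReal_re]
  linarith

lemma IsNonneg.lowerBound (h : IsNonneg T) : LowerBound T 0 := fun x => by
  simpa using h x

lemma LowerBound.isNonneg (h : LowerBound T 0) : IsNonneg T := fun x => by
  simpa using h x

end AddConst

section Complete

variable [CompleteSpace H] {T : H →ₗ.[ℂ] H}

lemma inner_map_eq_of_isSelfAdjoint (hT : IsSelfAdjoint T) (x y : T.domain) :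
    ⟪T x, (y : H)⟫_ℂ = ⟪(x : H), T y⟫_ℂ := by
  have h := LinearPMap.adjoint_isFormalAdjoint hT.dense_domain
  rw [LinearPMap.isSelfAdjoint_def.1 hT] at h
  exact h x y

lemma mem_domain_of_inner_eq (hT : IsSelfAdjoint T) {y w : H}
    (h : ∀ x : T.domain, ⟪w, (x : H)⟫_ℂ = ⟪y, T x⟫_ℂ) : ∃ hy : y ∈ T.domain, T ⟨y, hy⟩ = w := by
  have e := LinearPMap.isSelfAdjoint_def.1 hT
  have hy : y ∈ T.adjoint.domain := LinearPMap.mem_adjoint_domain_of_exists y ⟨w, h⟩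
  have h2 := LinearPMap.adjoint_apply_eq hT.dense_domain ⟨y, hy⟩ h
  have hg : (y, w) ∈ T.adjoint.graph := by
    rw [LinearPMap.mem_graph_iff]; exact ⟨⟨y, hy⟩, rfl, h2⟩
  rw [e, LinearPMap.mem_graph_iff] at hg
  obtain ⟨⟨v, hv⟩, rfl, h3⟩ := hg
  exact ⟨hv, h3⟩

/-- A symmetric operator that is bounded from below by `b`, and for which `z - T` is onto for
some real `z < b`, is self-adjoint. -/
lemma isSelfAdjoint_of_surjective (hs : ∀ x y : T.domain, ⟪T x, (y : H)⟫_ℂ = ⟪(x : H), T y⟫_ℂ)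
    {b z : ℝ} (hzb : z < b) (hb : ∀ x : T.domain, b * ‖(x : H)‖ ^ 2 ≤ (⟪(x : H), T x⟫_ℂ).re)
    (hsurj : ∀ y : H, ∃ x : T.domain, (z : ℂ) • (x : H) - T x = y) : IsSelfAdjoint T := by
  have hd : Dense (T.domain : Set H) := by
    rw [Submodule.dense_iff_topologicalClosure_eq_top, Submodule.topologicalClosure_eq_top_iff,
      Submodule.eq_bot_iff]
    intro y hy
    obtain ⟨x, rfl⟩ := hsurj y
    have h1 := (Submodule.mem_orthogonal _ _).1 hy x x.2
    have h2 := hb x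
    rw [inner_sub_right, inner_smul_right, sub_eq_zero, inner_self_eq_ofReal] at h1
    rw [← h1, ← Complex.ofReal_mul, Complex.ofReal_re] at h2
    have h3 : ‖(x : H)‖ = 0 := by
      by_contra hne
      have : 0 < ‖(x : H)‖ ^ 2 := by positivity
      nlinarith
    have h4 : x = 0 := Subtype.ext (norm_eq_zero.1 h3)
    simp [h4]
  have hle : T ≤ T.adjoint := LinearPMap.IsFormalAdjoint.le_adjoint hd hs
  refine LinearPMap.isSelfAdjoint_def.2 (le_antisymm ?_ hle)
  have hdom : T.adjoint.domain ≤ T.domain := by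
    intro y hy
    obtain ⟨x, hx⟩ := hsurj ((z : ℂ) • y - T.adjoint ⟨y, hy⟩)
    have h1 : ∀ v : T.domain, ⟪y - x, (z : ℂ) • (v : H) - T v⟫_ℂ = 0 := by
      intro v
      have e1 := LinearPMap.adjoint_isFormalAdjoint hd ⟨y, hy⟩ v
      have e2 := congrArg (fun u => ⟪u, (v : H)⟫_ℂ) hx
      simp only [inner_sub_left, inner_smul_left, Complex.conj_ofReal, hs x v] at e2
      simp only [inner_sub_left, inner_sub_right, inner_smul_right, ← e1]
      linear_combination -e2
    obtain ⟨v, hv⟩ := hsurj (y - x)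
    have h2 := h1 v
    rw [hv, inner_self_eq_zero, sub_eq_zero] at h2
    rw [h2]; exact x.2
  refine ⟨hdom, fun x y hxy => ?_⟩
  exact (hle.2 hxy.symm).symm

/-- If `T` is self-adjoint and `z - T` is bounded from below then `z - T` has a bounded inverse:
its range is closed, and a vector orthogonal to the range is in the kernel of `conj z - T`. -/
lemma exists_isResolventAt (hT : IsSelfAdjoint T) {z : ℂ} {c : ℝ} (hc : 0 < c)
    (h : ∀ x : T.domain, c * ‖(x : H)‖ ≤ ‖z • (x : H) - T x‖) :
    ∃ R : H →L[ℂ] H, IsResolventAt T z R := by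
  -- the lower bound holds for the conjugate of `z` too
  have h' : ∀ x : T.domain, c * ‖(x : H)‖ ≤ ‖(starRingEnd ℂ) z • (x : H) - T x‖ := by
    intro x
    refine (h x).trans (le_of_eq ?_)
    have e : ∀ u : ℂ, ‖u • (x : H) - T x‖ ^ 2 =
        ‖u‖ ^ 2 * ‖(x : H)‖ ^ 2 - 2 * (u * ⟪T x, (x : H)⟫_ℂ).re + ‖T x‖ ^ 2 := by
      intro u
      have := norm_sub_sq (𝕜 := ℂ) (u • (x : H)) (T x)
      rw [this, norm_smul, mul_pow, ← inner_re_symm, inner_smul_right]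
      rfl
    have hr : (⟪T x, (x : H)⟫_ℂ).im = 0 := by
      have := inner_map_eq_of_isSelfAdjoint hT x x
      have h2 := inner_conj_symm (𝕜 := ℂ) (x : H) (T x)
      rw [← this] at h2
      exact Complex.conj_eq_iff_im.1 h2
    have : ‖z • (x : H) - T x‖ ^ 2 = ‖(starRingEnd ℂ) z • (x : H) - T x‖ ^ 2 := by
      rw [e, e]; simp [Complex.mul_re, hr]
    exact (sq_eq_sq₀ (norm_nonneg _) (norm_nonneg _)).1 this
  have hclosed : IsClosed (T.graph : Set (H × H)) := hT.isClosed
  have : CompleteSpace T.graph := hclosed.completeSpace_coe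
  let L : T.graph →L[ℂ] H :=
    (z • ContinuousLinearMap.fst ℂ H H - ContinuousLinearMap.snd ℂ H H).comp T.graph.subtypeL
  have hL : ∀ p : T.graph, L p = z • (p : H × H).1 - (p : H × H).2 := fun p => rfl
  have hLb : ∀ p : T.graph, c * ‖(p : H × H).1‖ ≤ ‖L p‖ := by
    rintro ⟨p, hp⟩
    obtain ⟨x, h1, h2⟩ := (LinearPMap.mem_graph_iff _).1 hp
    rw [hL, ← h1, ← h2]; exact h x
  have hanti : AntilipschitzWith (Real.toNNReal (c⁻¹ + (‖z‖ * c⁻¹ + 1))) L := by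
    refine ContinuousLinearMap.antilipschitz_of_bound L fun p => ?_
    have hb := hLb p
    have h0 : 0 ≤ c⁻¹ + (‖z‖ * c⁻¹ + 1) := by positivity
    rw [Real.coe_toNNReal _ h0]
    have h1 : ‖(p : H × H).1‖ ≤ c⁻¹ * ‖L p‖ := by
      rw [inv_mul_eq_div, le_div_iff₀ hc]; linarith
    have h2 : ‖(p : H × H).2‖ ≤ (‖z‖ * c⁻¹ + 1) * ‖L p‖ := by
      have e : (p : H × H).2 = z • (p : H × H).1 - L p := by rw [hL]; abel
      calc ‖(p : H × H).2‖ ≤ ‖z • (p : H × H).1‖ + ‖L p‖ := by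
            rw [e]; exact norm_sub_le _ _
        _ ≤ ‖z‖ * (c⁻¹ * ‖L p‖) + ‖L p‖ := by rw [norm_smul]; gcongr
        _ = _ := by ring
    have h3 : ‖p‖ = max ‖(p : H × H).1‖ ‖(p : H × H).2‖ := rfl
    rw [h3, add_mul]
    have := norm_nonneg (L p)
    refine max_le (h1.trans ?_) (h2.trans ?_)
    · have : 0 ≤ (‖z‖ * c⁻¹ + 1) * ‖L p‖ := by positivity
      linarith
    · have : 0 ≤ c⁻¹ * ‖L p‖ := by positivity
      linarith
  have hrc : IsClosed (L.range : Set H) := by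
    have := hanti.isClosed_range L.uniformContinuous
    exact this
  have hrange : L.range = ⊤ := by
    have : CompleteSpace L.range := hrc.completeSpace_coe
    rw [← Submodule.orthogonal_eq_bot_iff, Submodule.eq_bot_iff]
    intro y hy
    have h1 : ∀ x : T.domain, ⟪z • (x : H) - T x, y⟫_ℂ = 0 := fun x =>
      (Submodule.mem_orthogonal _ _).1 hy _
        ⟨⟨((x : H), T x), LinearPMap.mem_graph T x⟩, rfl⟩
    have h2 : ∀ x : T.domain, ⟪(starRingEnd ℂ) z • y, (x : H)⟫_ℂ = ⟪y, T x⟫_ℂ := by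
      intro x
      have := congrArg (starRingEnd ℂ) (h1 x)
      rw [inner_conj_symm, inner_sub_right, inner_smul_right, map_zero, sub_eq_zero] at this
      rw [inner_smul_left, Complex.conj_conj, this]
    obtain ⟨hy', e⟩ := mem_domain_of_inner_eq hT h2
    have h3 := h' ⟨y, hy'⟩
    rw [e, sub_self, norm_zero] at h3
    have : ‖y‖ ≤ 0 := by
      by_contra hh; push Not at hh
      have := mul_pos hc hh
      exact absurd h3 (not_le.2 this)
    exact norm_le_zero_iff.1 this
  let L₀ : T.domain →ₗ[ℂ] H := z • T.domain.subtype - T.toFun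
  have hL₀ : ∀ x, L₀ x = z • (x : H) - T x := fun x => rfl
  have hinj : Function.Injective L₀ := by
    refine (injective_iff_map_eq_zero _).2 fun x hx => ?_
    have h1 := h x
    rw [← hL₀, hx, norm_zero] at h1
    have : ‖(x : H)‖ ≤ 0 := by
      by_contra hh; push Not at hh
      exact absurd h1 (not_le.2 (mul_pos hc hh))
    exact Subtype.ext (norm_le_zero_iff.1 this)
  have hsurj : Function.Surjective L₀ := by
    intro y
    obtain ⟨⟨p, hp⟩, e⟩ : y ∈ L.range := hrange ▸ Submodule.mem_top
    obtain ⟨x, h1, h2⟩ := (LinearPMap.mem_graph_iff _).1 hp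
    exact ⟨x, by rw [hL₀, h1, h2]; exact e⟩
  let e := LinearEquiv.ofBijective L₀ ⟨hinj, hsurj⟩
  have he : ∀ y, L₀ (e.symm y) = y := fun y => e.apply_symm_apply y
  refine ⟨(T.domain.subtype ∘ₗ e.symm.toLinearMap).mkContinuous c⁻¹ fun y => ?_, ?_, ?_⟩
  · have h1 := h (e.symm y)
    rw [← hL₀, he] at h1
    change ‖((e.symm y : T.domain) : H)‖ ≤ _
    rw [inv_mul_eq_div, le_div_iff₀ hc]; linarith
  · exact fun y => ⟨(e.symm y).2, he y⟩
  · intro x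
    change ((e.symm (L₀ x) : T.domain) : H) = x
    have : e.symm (L₀ x) = x := e.symm_apply_apply x
    rw [this]

lemma im_inner_map_eq_zero (hT : IsSelfAdjoint T) (x : T.domain) :
    (⟪(x : H), T x⟫_ℂ).im = 0 := by
  have := inner_map_eq_of_isSelfAdjoint hT x x
  have h2 := inner_conj_symm (𝕜 := ℂ) (T x) (x : H)
  rw [this] at h2
  exact Complex.conj_eq_iff_im.1 h2

/-- The spectrum of a self-adjoint operator `T ≥ b` is contained in `[b, ∞)`. -/
lemma exists_isResolventAt_of_lowerBound (hT : IsSelfAdjoint T) {b : ℝ}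
    (hb : LowerBound T b) {z : ℂ}
    (hz : ∀ s : ℝ, b ≤ s → z ≠ s) : ∃ R : H →L[ℂ] H, IsResolventAt T z R := by
  have key : ∀ x : T.domain, ⟪(x : H), z • (x : H) - T x⟫_ℂ =
      z * ((‖(x : H)‖ ^ 2 : ℝ) : ℂ) - ⟪(x : H), T x⟫_ℂ := by
    intro x
    rw [inner_sub_right, inner_smul_right, inner_self_eq_ofReal]
  -- it suffices to bound the quadratic form of `z - T` from below
  suffices ∃ c : ℝ, 0 < c ∧ ∀ x : T.domain,
      c * ‖(x : H)‖ ^ 2 ≤ ‖⟪(x : H), z • (x : H) - T x⟫_ℂ‖ by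
    obtain ⟨c, hc, hx⟩ := this
    refine exists_isResolventAt hT hc fun x => ?_
    rcases (norm_nonneg (x : H)).eq_or_lt with h0 | h0
    · rw [← h0]; simp
    · have := (hx x).trans (norm_inner_le_norm (x : H) _)
      have h2 : ‖(x : H)‖ * (c * ‖(x : H)‖) ≤ ‖(x : H)‖ * ‖z • (x : H) - T x‖ := by
        linarith [this]
      exact le_of_mul_le_mul_left h2 h0
  by_cases him : z.im = 0
  · have hzb : z.re < b := by
      by_contra hh; push Not at hh
      exact hz z.re hh (Complex.ext (by simp) (by simp [him]))
    refine ⟨b - z.re, by linarith, fun x => ?_⟩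
    refine le_trans ?_ (Complex.abs_re_le_norm _)
    rw [key, Complex.sub_re, Complex.re_mul_ofReal]
    refine le_trans ?_ (neg_le_abs _)
    have := hb x
    nlinarith
  · refine ⟨|z.im|, abs_pos.2 him, fun x => ?_⟩
    refine le_trans ?_ (Complex.abs_im_le_norm _)
    rw [key, Complex.sub_im, Complex.im_mul_ofReal, im_inner_map_eq_zero hT, sub_zero, abs_mul,
      abs_of_nonneg (sq_nonneg ‖(x : H)‖)]

lemma isResolventAt_resolventOp (hT : IsSelfAdjoint T) {b : ℝ} (hb : LowerBound T b) {z : ℂ}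
    (hz : ∀ s : ℝ, b ≤ s → z ≠ s) : IsResolventAt T z (resolventOp T z) := by
  obtain ⟨R, hR⟩ := exists_isResolventAt_of_lowerBound hT hb hz
  rwa [hR.resolventOp_eq]

lemma isSelfAdjoint_addConst (hT : IsSelfAdjoint T) (a : ℝ) : IsSelfAdjoint (addConst T a) := by
  have hd : Dense ((addConst T a).domain : Set H) := hT.dense_domain
  have hs : ∀ x y : (addConst T a).domain,
      ⟪addConst T a x, (y : H)⟫_ℂ = ⟪(x : H), addConst T a y⟫_ℂ := by
    intro x y
    rw [addConst_apply, addConst_apply, inner_add_left, inner_add_right, inner_smul_left,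
      inner_smul_right, inner_map_eq_of_isSelfAdjoint hT ⟨x, x.2⟩ ⟨y, y.2⟩]
    simp
  have hle : addConst T a ≤ (addConst T a).adjoint := LinearPMap.IsFormalAdjoint.le_adjoint hd hs
  refine LinearPMap.isSelfAdjoint_def.2 (le_antisymm ?_ hle)
  refine ⟨fun y hy => ?_, fun x y hxy => (hle.2 hxy.symm).symm⟩
  · obtain ⟨hy', -⟩ := mem_domain_of_inner_eq hT
      (y := y) (w := (addConst T a).adjoint ⟨y, hy⟩ - (a : ℂ) • y) fun x => by
        have := LinearPMap.adjoint_isFormalAdjoint hd ⟨y, hy⟩ ⟨x, x.2⟩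
        rw [addConst_apply, inner_add_right, inner_smul_right] at this
        rw [inner_sub_left, this, inner_smul_left]
        simp
    exact hy'

end Complete

/-! ### The functional calculus of a self-adjoint operator bounded from below -/

section Products

variable {S T : H →ₗ.[ℂ] H} {R K L : H →L[ℂ] H}

lemma IsBoundedProduct.boundedProduct_eq (h : IsBoundedProduct S R K) :
    boundedProduct S R = K := by
  have hex : ∃ K : H →L[ℂ] H, IsBoundedProduct S R K := ⟨K, h⟩
  rw [boundedProduct, dif_pos hex]
  ext x
  obtain ⟨_, e1⟩ := hex.choose_spec x
  obtain ⟨_, e2⟩ := h x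
  exact e1.symm.trans e2

lemma IsBoundedProduct.mul_right (h : IsBoundedProduct S R K) (L : H →L[ℂ] H) :
    IsBoundedProduct S (R * L) (K * L) := fun x => h (L x)

end Products

/-- `g` is continuous on `[b, ∞)` with limit `c` at infinity. -/
structure Admissible (b : ℝ) (c : ℂ) (g : ℝ → ℂ) : Prop where
  continuousOn : ContinuousOn g (Set.Ici b)
  tendsto : Tendsto g atTop (𝓝 c)

namespace Admissible

variable {b : ℝ} {c d : ℂ} {f g : ℝ → ℂ}

lemma mul (hf : Admissible b c f) (hg : Admissible b d g) :
    Admissible b (c * d) fun s => f s * g s :=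
  ⟨hf.1.mul hg.1, hf.2.mul hg.2⟩

lemma add (hf : Admissible b c f) (hg : Admissible b d g) :
    Admissible b (c + d) fun s => f s + g s :=
  ⟨hf.1.add hg.1, hf.2.add hg.2⟩

lemma sub (hf : Admissible b c f) (hg : Admissible b d g) :
    Admissible b (c - d) fun s => f s - g s :=
  ⟨hf.1.sub hg.1, hf.2.sub hg.2⟩

lemma const (b : ℝ) (c : ℂ) : Admissible b c fun _ => c :=
  ⟨continuousOn_const, tendsto_const_nhds⟩

lemma congr (hf : Admissible b c f) (h : ∀ s, b ≤ s → g s = f s) : Admissible b c g :=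
  ⟨hf.1.congr fun s hs => h s hs,
    hf.2.congr' ((eventually_ge_atTop b).mono fun s hs => (h s hs).symm)⟩

/-- If `r(s) g(s)` has a limit at infinity, where `r` tends to infinity, then `g` vanishes
there. -/
lemma of_mul (hf : ContinuousOn g (Set.Ici b)) {r : ℝ → ℝ} (hr : Tendsto r atTop atTop)
    (h : Tendsto (fun s => (r s : ℂ) * g s) atTop (𝓝 c)) : Admissible b 0 g := by
  refine ⟨hf, ?_⟩
  have h1 : Tendsto (fun s => ((r s)⁻¹ : ℂ)) atTop (𝓝 0) := by
    have := (Complex.continuous_ofReal.tendsto 0).comp (tendsto_inv_atTop_zero.comp hr)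
    simpa [Function.comp_def] using this
  have := h1.mul h
  rw [zero_mul] at this
  refine this.congr' ((hr.eventually_gt_atTop 0).mono fun s hs => ?_)
  have : (r s : ℂ) ≠ 0 := by exact_mod_cast hs.ne'
  field_simp

lemma inv_of_tendsto (hf : ContinuousOn g (Set.Ici b)) (h0 : ∀ s, b ≤ s → g s ≠ 0)
    (h : Tendsto (fun s => ‖g s‖) atTop atTop) : Admissible b 0 fun s => (g s)⁻¹ :=
  ⟨hf.inv₀ h0, (tendsto_inv₀_cobounded.comp (tendsto_norm_atTop_iff_cobounded.1 h))⟩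

lemma inv_sub (b : ℝ) {z : ℂ} (hz : ∀ s : ℝ, b ≤ s → z ≠ s) :
    Admissible b 0 fun s => (z - s)⁻¹ := by
  refine inv_of_tendsto (by fun_prop) (fun s hs => sub_ne_zero.2 (hz s hs)) ?_
  refine tendsto_atTop_mono (f := fun s : ℝ => s - ‖z‖) (fun s => ?_)
    (tendsto_atTop_add_const_right _ _ tendsto_id)
  have h1 := norm_sub_norm_le (s : ℂ) z
  rw [norm_sub_rev] at h1
  rw [Complex.norm_real] at h1
  exact (sub_le_sub_right (le_abs_self s) _).trans h1

lemma mul_inv_sub (b : ℝ) {z : ℂ} (hz : ∀ s : ℝ, b ≤ s → z ≠ s) :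
    Admissible b (-1) fun s => s * (z - s)⁻¹ := by
  have := ((const b z).mul (inv_sub b hz)).sub (const b 1)
  rw [mul_zero, zero_sub] at this
  refine this.congr fun s hs => ?_
  have := sub_ne_zero.2 (hz s hs)
  field_simp
  ring

lemma inv_add_I (b : ℝ) : Admissible b 0 fun s => ((s : ℂ) + Complex.I)⁻¹ := by
  have h : ∀ s : ℝ, b ≤ s → -Complex.I ≠ s := fun s _ h => by
    have := congrArg Complex.im h
    simp at this
  have := (const b (-1)).mul (inv_sub b h)
  rw [mul_zero] at this
  refine this.congr fun s _ => ?_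
  rw [← inv_neg_one, ← mul_inv]
  congr 1; ring

lemma sqrt_mul_inv_sub (b : ℝ) {z : ℂ} (hz : ∀ s : ℝ, b ≤ s → z ≠ s) :
    Admissible b 0 fun s => (√s : ℂ) * (z - s)⁻¹ := by
  refine of_mul (r := fun s => √s) (c := -1) ?_ Real.tendsto_sqrt_atTop ?_
  · exact (Complex.continuous_ofReal.comp Real.continuous_sqrt).continuousOn.mul (inv_sub b hz).1
  · refine (mul_inv_sub b hz).2.congr' ((eventually_ge_atTop 0).mono fun s hs => ?_)
    simp only
    rw [← mul_assoc, ← Complex.ofReal_mul, Real.mul_self_sqrt hs]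

lemma one_add_sqrt_ne (s : ℝ) : (1 + (√s : ℂ)) ≠ 0 := by
  have : (0 : ℝ) < 1 + √s := by positivity
  exact_mod_cast this.ne'

lemma inv_one_add_sqrt (b : ℝ) : Admissible b 0 fun s => (1 + (√s : ℂ))⁻¹ := by
  refine inv_of_tendsto ?_ (fun s _ => one_add_sqrt_ne s) ?_
  · exact (continuous_const.add
      (Complex.continuous_ofReal.comp Real.continuous_sqrt)).continuousOn
  · refine tendsto_atTop_mono (fun s => ?_) Real.tendsto_sqrt_atTop
    have : ‖(1 + (√s : ℂ))‖ = 1 + √s := by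
      have h : (1 + (√s : ℂ)) = ((1 + √s : ℝ) : ℂ) := by push_cast; ring
      rw [h, Complex.norm_real, Real.norm_of_nonneg (by positivity)]
    rw [this]; linarith

/-- A function that differs from `1` by `O((1 + √s)⁻¹)` tends to `1`. -/
lemma of_norm_sub_one_le (hf : ContinuousOn g (Set.Ici b)) {M : ℝ}
    (h : ∀ s, 0 ≤ s → ‖g s - 1‖ ≤ M * (1 + √s)⁻¹) : Admissible b 1 g := by
  refine ⟨hf, tendsto_iff_norm_sub_tendsto_zero.2 ?_⟩
  have h1 : Tendsto (fun s : ℝ => M * (1 + √s)⁻¹) atTop (𝓝 0) := by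
    have := tendsto_inv_atTop_zero.comp
      (tendsto_atTop_add_const_left atTop (1 : ℝ) Real.tendsto_sqrt_atTop)
    simpa using this.const_mul M
  exact squeeze_zero' (Eventually.of_forall fun _ => norm_nonneg _)
    ((eventually_ge_atTop 0).mono h) h1

lemma exp_neg_mul (b : ℝ) {t : ℝ} (ht : 0 < t) :
    Admissible b 0 fun s => Complex.exp (-((t * s : ℝ) : ℂ)) := by
  refine ⟨by fun_prop, ?_⟩
  rw [tendsto_zero_iff_norm_tendsto_zero]
  have h : ∀ s : ℝ, ‖Complex.exp (-((t * s : ℝ) : ℂ))‖ = Real.exp (-(t * s)) := fun s => by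
    rw [← Complex.ofReal_neg, ← Complex.ofReal_exp, Complex.norm_real,
      Real.norm_of_nonneg (Real.exp_pos _).le]
  simp only [h]
  exact Real.tendsto_exp_neg_atTop_nhds_zero.comp (tendsto_id.const_mul_atTop ht)

end Admissible

section Complete

variable [CompleteSpace H]

/-- `T` is self-adjoint and bounded from below by `b`. -/
structure SelfAdjointGE (T : H →ₗ.[ℂ] H) (b : ℝ) : Prop where
  isSelfAdjoint : IsSelfAdjoint T
  lowerBound : LowerBound T b

/-- The bounded operator `(T + i)⁻¹`. -/
def cayleyRes (T : H →ₗ.[ℂ] H) : H →L[ℂ] H := -(resolventOp T (-Complex.I))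

/-- The function of a spectral value `w = (s + i)⁻¹` of `(T + i)⁻¹` that corresponds to the
function `g` of `s` with the limit `c` at infinity. -/
def calcFun (c : ℂ) (g : ℝ → ℂ) (w : ℂ) : ℂ := if w = 0 then c else g (w⁻¹ - Complex.I).re

/-- The function `g` of the self-adjoint operator `T`, where `g` has the limit `c` at infinity.
This extends `funcCalc`, which is the case `c = 0`. -/
def opFun (T : H →ₗ.[ℂ] H) (c : ℂ) (g : ℝ → ℂ) : H →L[ℂ] H := cfc (calcFun c g) (cayleyRes T)

variable {T : H →ₗ.[ℂ] H} {b : ℝ} {c d : ℂ} {f g : ℝ → ℂ}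

lemma funcCalc_eq (T : H →ₗ.[ℂ] H) (f : ℝ → ℂ) : funcCalc T f = opFun T 0 f := rfl

lemma star_opFun (T : H →ₗ.[ℂ] H) (c : ℂ) (f : ℝ → ℂ) :
    star (opFun T c f) = opFun T (starRingEnd ℂ c) fun s => starRingEnd ℂ (f s) := by
  rw [opFun, opFun, ← cfc_star]
  congr 1
  ext w
  simp only [calcFun]
  split_ifs <;> rfl

namespace SelfAdjointGE

variable (hT : SelfAdjointGE T b)
include hT

lemma isResolventAt {z : ℂ} (hz : ∀ s : ℝ, b ≤ s → z ≠ s) :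
    IsResolventAt T z (resolventOp T z) :=
  isResolventAt_resolventOp hT.1 hT.2 hz

lemma isResolventAt_of_im {z : ℂ} (hz : z.im ≠ 0) : IsResolventAt T z (resolventOp T z) :=
  hT.isResolventAt fun s _ h => hz (by rw [h]; simp)

lemma mono {b' : ℝ} (h : b' ≤ b) : SelfAdjointGE T b' :=
  ⟨hT.1, fun x => (mul_le_mul_of_nonneg_right h (sq_nonneg _)).trans (hT.2 x)⟩

lemma addConst (a : ℝ) : SelfAdjointGE (addConst T a) (b + a) :=
  ⟨isSelfAdjoint_addConst hT.1 a, hT.2.addConst a⟩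

lemma adjoint_resolventOp {z : ℂ} (hz : z.im ≠ 0) :
    star (resolventOp T z) = resolventOp T (starRingEnd ℂ z) := by
  have h1 := hT.isResolventAt_of_im hz
  have h2 := hT.isResolventAt_of_im (z := starRingEnd ℂ z) (by simpa using hz)
  rw [ContinuousLinearMap.star_eq_adjoint]
  refine (ContinuousLinearMap.eq_adjoint_iff _ _).2 (fun x y => ?_) |>.symm
  -- write `y = (z - T) R y` and move `z - T` to the left
  obtain ⟨hx, ex⟩ := h2.1 x
  obtain ⟨hy, ey⟩ := h1.1 y
  have h3 := inner_map_eq_of_isSelfAdjoint hT.1 ⟨_, hx⟩ ⟨_, hy⟩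
  have e1 : ⟪resolventOp T (starRingEnd ℂ z) x, y⟫_ℂ =
      ⟪resolventOp T (starRingEnd ℂ z) x, z • resolventOp T z y - T ⟨_, hy⟩⟫_ℂ := by rw [ey]
  have e2 : ⟪x, resolventOp T z y⟫_ℂ =
      ⟪(starRingEnd ℂ) z • resolventOp T (starRingEnd ℂ z) x - T ⟨_, hx⟩,
        resolventOp T z y⟫_ℂ := by rw [ex]
  rw [e1, e2, inner_sub_left, inner_sub_right, inner_smul_left, inner_smul_right, h3,
    Complex.conj_conj]

lemma isStarNormal : IsStarNormal (cayleyRes T) := by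
  have h : (-Complex.I).im ≠ 0 := by simp
  refine ⟨?_⟩
  rw [cayleyRes, star_neg, hT.adjoint_resolventOp h]
  exact ((hT.isResolventAt_of_im (by simp)).commute (hT.isResolventAt_of_im h)).neg_left.neg_right

/-- Nonzero spectral values of `(T + i)⁻¹` are of the form `(s + i)⁻¹` with `s ≥ b`. -/
lemma exists_of_mem_spectrum {w : ℂ} (hw : w ∈ spectrum ℂ (cayleyRes T)) (h0 : w ≠ 0) :
    ∃ s : ℝ, b ≤ s ∧ w⁻¹ - Complex.I = s := by
  by_contra hcon
  push Not at hcon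
  set z : ℂ := w⁻¹ - Complex.I with hz
  have hR := hT.isResolventAt hcon
  have hS := hT.isResolventAt_of_im (z := -Complex.I) (by simp)
  set R := resolventOp T z
  set S := resolventOp T (-Complex.I)
  have hzI : z + Complex.I = w⁻¹ := by rw [hz]; ring
  have hcomm : R * S = S * R := hR.commute hS
  have hid : R - S = -(w⁻¹ • (R * S)) := by
    rw [hR.sub_eq hS, ← neg_smul, ← hzI]; congr 1; ring
  have hN : cayleyRes T = -S := rfl
  refine hw ?_
  rw [spectrum.mem_resolventSet_iff, hN, sub_neg_eq_add]
  -- the inverse of `w - N` is `w⁻¹ (1 - w⁻¹ R)`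
  have key : ∀ X Y : H →L[ℂ] H, X = algebraMap ℂ (H →L[ℂ] H) w + S → Y = 1 - w⁻¹ • R →
      X * Y = w • 1 ∧ Y * X = w • 1 := by
    rintro X Y rfl rfl
    have e1 : S * R = R * S := hcomm.symm
    rw [Algebra.algebraMap_eq_smul_one]
    constructor
    · simp only [add_mul, mul_sub, mul_one, smul_mul_assoc, one_mul, mul_smul_comm, e1]
      have : w⁻¹ • (R * S) = S - R := by rw [← neg_sub, hid, neg_neg]
      rw [smul_add, this, smul_smul, inv_mul_cancel₀ h0, one_smul]; abel
    · simp only [mul_add, sub_mul, mul_one, smul_mul_assoc, one_mul, mul_smul_comm, smul_sub,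
        smul_smul, mul_inv_cancel₀ h0, one_smul]
      have : w⁻¹ • (R * S) = S - R := by rw [← neg_sub, hid, neg_neg]
      rw [this]; abel
  obtain ⟨k1, k2⟩ := key _ _ rfl rfl
  refine isUnit_iff_exists.2 ⟨w⁻¹ • (1 - w⁻¹ • R), ?_, ?_⟩
  · rw [mul_smul_comm, k1, smul_smul, inv_mul_cancel₀ h0, one_smul]
  · rw [smul_mul_assoc, k2, smul_smul, inv_mul_cancel₀ h0, one_smul]

lemma continuousOn_calcFun (hg : Admissible b c g) :
    ContinuousOn (calcFun c g) (spectrum ℂ (cayleyRes T)) := by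
  intro w₀ hw₀
  have hmaps : ∀ w ∈ spectrum ℂ (cayleyRes T), w ≠ 0 → (w⁻¹ - Complex.I).re ∈ Set.Ici b := by
    intro w hw h0
    obtain ⟨s, hs, e⟩ := hT.exists_of_mem_spectrum hw h0
    rw [e]; simpa using hs
  by_cases h0 : w₀ = 0
  · subst h0
    rw [← continuousWithinAt_sdiff_self]
    -- `w → 0` means `|s| → ∞`, hence `s → ∞` as `s ≥ b`
    have hlim : Tendsto (fun w : ℂ => (w⁻¹ - Complex.I).re)
        (𝓝[spectrum ℂ (cayleyRes T) \ {0}] 0) atTop := by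
      have h1 : Tendsto (fun w : ℂ => ‖w⁻¹‖) (𝓝[spectrum ℂ (cayleyRes T) \ {0}] 0) atTop := by
        refine (tendsto_norm_atTop_iff_cobounded.2 tendsto_inv₀_nhdsNE_zero).mono_left
          (nhdsWithin_mono _ fun w hw => hw.2)
      rw [tendsto_atTop]
      intro M
      filter_upwards [h1.eventually_gt_atTop (|M| + |b| + 1), self_mem_nhdsWithin] with w hw hw2
      obtain ⟨s, hs, e⟩ := hT.exists_of_mem_spectrum hw2.1 hw2.2
      rw [e, Complex.ofReal_re]
      have h2 : ‖w⁻¹‖ ≤ |s| + 1 := by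
        have : w⁻¹ = s + Complex.I := by rw [← e]; ring
        rw [this]
        refine (norm_add_le _ _).trans ?_
        simp
      rcases abs_cases s with ⟨h3, _⟩ | ⟨h3, _⟩
      · have := le_abs_self M
        have := abs_nonneg b
        linarith
      · have := neg_abs_le b
        have := abs_nonneg M
        linarith
    have h3 : Tendsto (fun w : ℂ => g (w⁻¹ - Complex.I).re)
        (𝓝[spectrum ℂ (cayleyRes T) \ {0}] 0) (𝓝 c) := hg.2.comp hlim
    have h4 : calcFun c g 0 = c := by simp [calcFun]
    rw [ContinuousWithinAt, h4]
    refine h3.congr' ?_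
    filter_upwards [self_mem_nhdsWithin] with w hw
    have hw2 : w ≠ 0 := hw.2
    rw [calcFun, if_neg hw2]
  · have hnhds : {w : ℂ | w ≠ 0} ∈ 𝓝 w₀ := isOpen_ne.mem_nhds h0
    have hc : ContinuousWithinAt (fun w : ℂ => g (w⁻¹ - Complex.I).re)
        (spectrum ℂ (cayleyRes T) ∩ {w : ℂ | w ≠ 0}) w₀ := by
      refine ContinuousWithinAt.comp (t := Set.Ici b) (hg.1 _ (hmaps w₀ hw₀ h0)) ?_
        (fun w hw => hmaps w hw.1 hw.2)
      refine ContinuousAt.continuousWithinAt ?_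
      exact Complex.continuous_re.continuousAt.comp ((continuousAt_inv₀ h0).sub continuousAt_const)
    have hc' : ContinuousWithinAt (calcFun c g)
        (spectrum ℂ (cayleyRes T) ∩ {w : ℂ | w ≠ 0}) w₀ := by
      refine hc.congr (fun w hw => ?_) ?_
      · rw [calcFun, if_neg hw.2]
      · rw [calcFun, if_neg h0]
    exact (continuousWithinAt_inter hnhds).1 hc'

lemma opFun_congr (h : ∀ s, b ≤ s → f s = g s) :
    opFun T c f = opFun T c g := by
  refine cfc_congr fun w hw => ?_
  simp only [calcFun]
  split_ifs with h0
  · rfl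
  · obtain ⟨s, hs, e⟩ := hT.exists_of_mem_spectrum hw h0
    rw [e, Complex.ofReal_re, h s hs]

lemma opFun_mul (hf : Admissible b c f) (hg : Admissible b d g) :
    opFun T c f * opFun T d g = opFun T (c * d) fun s => f s * g s := by
  rw [opFun, opFun, opFun, ← cfc_mul _ _ _
    (hT.continuousOn_calcFun hf) (hT.continuousOn_calcFun hg)]
  congr 1
  ext w
  simp only [calcFun]
  split_ifs <;> rfl

lemma opFun_add (hf : Admissible b c f) (hg : Admissible b d g) :
    opFun T c f + opFun T d g = opFun T (c + d) fun s => f s + g s := by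
  rw [opFun, opFun, opFun, ← cfc_add _ _ _
    (hT.continuousOn_calcFun hf) (hT.continuousOn_calcFun hg)]
  congr 1
  ext w
  simp only [calcFun]
  split_ifs <;> rfl

lemma opFun_smul (r : ℂ) (hf : Admissible b c f) :
    r • opFun T c f = opFun T (r * c) fun s => r * f s := by
  rw [opFun, opFun, ← cfc_smul r _ _ (hT.continuousOn_calcFun hf)]
  congr 1
  ext w
  simp only [calcFun]
  split_ifs <;> rfl

lemma opFun_sub (hf : Admissible b c f) (hg : Admissible b d g) :
    opFun T c f - opFun T d g = opFun T (c - d) fun s => f s - g s := by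
  rw [opFun, opFun, opFun, ← cfc_sub _ _ _
    (hT.continuousOn_calcFun hf) (hT.continuousOn_calcFun hg)]
  congr 1
  ext w
  simp only [calcFun]
  split_ifs <;> rfl

lemma opFun_const (c : ℂ) : opFun T c (fun _ => c) = c • 1 := by
  have := hT.isStarNormal
  rw [opFun, ← Algebra.algebraMap_eq_smul_one, ← cfc_const c (cayleyRes T)]
  congr 1
  ext w
  simp [calcFun]

lemma opFun_one : opFun T 1 (fun _ => 1) = 1 := by
  rw [hT.opFun_const, one_smul]

lemma norm_opFun_le {M : ℝ} (hM : 0 ≤ M) (hc : ‖c‖ ≤ M) (h : ∀ s, b ≤ s → ‖g s‖ ≤ M) :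
    ‖opFun T c g‖ ≤ M := by
  refine norm_cfc_le hM fun w hw => ?_
  simp only [calcFun]
  split_ifs with h0
  · exact hc
  · obtain ⟨s, hs, e⟩ := hT.exists_of_mem_spectrum hw h0
    rw [e, Complex.ofReal_re]
    exact h s hs

lemma cayleyRes_eq : cayleyRes T = opFun T 0 fun s => ((s : ℂ) + Complex.I)⁻¹ := by
  have := hT.isStarNormal
  have h : opFun T 0 (fun s => ((s : ℂ) + Complex.I)⁻¹) = cfc (fun w : ℂ => w) (cayleyRes T) := by
    refine cfc_congr fun w hw => ?_
    simp only [calcFun]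
    split_ifs with h0
    · exact h0.symm
    · obtain ⟨s, hs, e⟩ := hT.exists_of_mem_spectrum hw h0
      rw [e, Complex.ofReal_re, ← e, sub_add_cancel, inv_inv]
  rw [h, cfc_id' ℂ (cayleyRes T)]

lemma isBoundedProduct_cayleyRes :
    IsBoundedProduct T (cayleyRes T) (1 - Complex.I • cayleyRes T) := by
  intro x
  have hS := hT.isResolventAt_of_im (z := -Complex.I) (by simp)
  obtain ⟨h, e⟩ := hS.1 x
  refine ⟨T.domain.neg_mem h, ?_⟩
  have h1 : (⟨cayleyRes T x, T.domain.neg_mem h⟩ : T.domain) = -⟨_, h⟩ := rfl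
  rw [h1, LinearPMap.map_neg]
  have h2 : (1 - Complex.I • cayleyRes T) x = x + Complex.I • resolventOp T (-Complex.I) x := by
    change x - Complex.I • (-(resolventOp T (-Complex.I) x)) = _
    rw [smul_neg, sub_neg_eq_add]
  rw [h2, eq_comm, ← sub_eq_zero]
  rw [← sub_eq_zero] at e
  rw [← neg_eq_zero, ← e, neg_smul]
  abel

/-- `T g(T) = (s ↦ s g(s))(T)`. -/
lemma isBoundedProduct_opFun (hg : ContinuousOn g (Set.Ici b))
    (hsg : Tendsto (fun s : ℝ => (s : ℂ) * g s) atTop (𝓝 c)) :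
    IsBoundedProduct T (opFun T 0 g) (opFun T c fun s => s * g s) := by
  have h0 : Admissible b 0 g := Admissible.of_mul hg tendsto_id hsg
  have h1 : Admissible b c fun s => (s : ℂ) * g s :=
    ⟨Complex.continuous_ofReal.continuousOn.mul hg, hsg⟩
  have h2 : Admissible b c fun s => (s + Complex.I) * g s := by
    have := h1.add ((Admissible.const b Complex.I).mul h0)
    rw [mul_zero, add_zero] at this
    exact this.congr fun s _ => by ring
  have e1 : opFun T 0 g = cayleyRes T * opFun T c fun s => (s + Complex.I) * g s := by
    rw [hT.cayleyRes_eq, hT.opFun_mul (Admissible.inv_add_I b) h2, zero_mul]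
    refine hT.opFun_congr fun s _ => ?_
    have : (s : ℂ) + Complex.I ≠ 0 := fun h => by
      have := congrArg Complex.im h
      simp at this
    field_simp
  have e2 : (1 - Complex.I • cayleyRes T) * opFun T c (fun s => (s + Complex.I) * g s) =
      opFun T c fun s => s * g s := by
    rw [sub_mul, one_mul, smul_mul_assoc, ← e1, hT.opFun_smul _ h0,
      hT.opFun_sub h2 ((Admissible.const b Complex.I).mul h0), mul_zero, sub_zero]
    exact hT.opFun_congr fun s _ => by ring
  rw [e1, ← e2]
  exact hT.isBoundedProduct_cayleyRes.mul_right _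

lemma resolventOp_eq {z : ℂ} (hz : ∀ s : ℝ, b ≤ s → z ≠ s) :
    resolventOp T z = opFun T 0 fun s => (z - s)⁻¹ := by
  refine ((hT.isResolventAt hz).eq_of_right_inverse fun y => ?_).symm
  have h1 := Admissible.inv_sub b hz
  have h2 := Admissible.mul_inv_sub b hz
  obtain ⟨h, e⟩ := hT.isBoundedProduct_opFun h1.1 h2.2 y
  refine ⟨h, ?_⟩
  rw [e]
  have : z • opFun T 0 (fun s => (z - s)⁻¹) - opFun T (-1) (fun s => s * (z - s)⁻¹) = 1 := by
    rw [hT.opFun_smul _ h1, hT.opFun_sub ((Admissible.const b z).mul h1) h2, ← hT.opFun_one]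
    have : z * 0 - -1 = 1 := by ring
    rw [this]
    refine hT.opFun_congr fun s hs => ?_
    have := sub_ne_zero.2 (hz s hs)
    field_simp
  exact congrArg (fun X : H →L[ℂ] H => X y) this

lemma isBoundedProduct_resolventOp {z : ℂ} (hz : ∀ s : ℝ, b ≤ s → z ≠ s) :
    IsBoundedProduct T (resolventOp T z) (opFun T (-1) fun s => s * (z - s)⁻¹) := by
  rw [hT.resolventOp_eq hz]
  exact hT.isBoundedProduct_opFun (Admissible.inv_sub b hz).1 (Admissible.mul_inv_sub b hz).2

end SelfAdjointGE

end Complete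

/-! ### The square root and shifts by constants -/

section Complete

variable [CompleteSpace H] {T : H →ₗ.[ℂ] H} {b : ℝ} {c d : ℂ} {f g : ℝ → ℂ}

/-- The bounded operator `(1 + √T)⁻¹`. -/
def sqrtRes (T : H →ₗ.[ℂ] H) : H →L[ℂ] H := opFun T 0 fun s => (1 + (√s : ℂ))⁻¹

lemma funcCalc_eq_sqrtRes (T : H →ₗ.[ℂ] H) :
    funcCalc T (fun s => (((1 + √s)⁻¹ : ℝ) : ℂ)) = sqrtRes T := by
  rw [funcCalc_eq, sqrtRes]
  congr 1
  ext s
  push_cast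
  rfl

lemma star_sqrtRes (T : H →ₗ.[ℂ] H) : star (sqrtRes T) = sqrtRes T := by
  rw [sqrtRes, star_opFun]
  simp

lemma inner_sqrtRes (T : H →ₗ.[ℂ] H) (x y : H) : ⟪sqrtRes T x, y⟫_ℂ = ⟪x, sqrtRes T y⟫_ℂ := by
  nth_rw 2 [← star_sqrtRes T]
  rw [ContinuousLinearMap.star_eq_adjoint, ContinuousLinearMap.adjoint_inner_right]

namespace SelfAdjointGE

variable (hT : SelfAdjointGE T b)
include hT

lemma sqrtRes_injective {x : H} (hx : sqrtRes T x = 0) : x = 0 := by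
  have h1 : Admissible b 0 fun s => (1 + (√s : ℂ)) * ((s : ℂ) + Complex.I)⁻¹ := by
    have hI : ∀ s : ℝ, b ≤ s → -Complex.I ≠ s := fun s _ h => by
      have := congrArg Complex.im h
      simp at this
    have := (Admissible.inv_add_I b).add
      ((Admissible.const b (-1)).mul (Admissible.sqrt_mul_inv_sub b hI))
    rw [mul_zero, add_zero] at this
    refine this.congr fun s _ => ?_
    have h3 : (-Complex.I - s : ℂ) = -(s + Complex.I) := by ring
    rw [h3, inv_neg]; ring
  -- `(T + i)⁻¹` factors through `(1 + √T)⁻¹`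
  have h2 : cayleyRes T = opFun T 0 (fun s => (1 + (√s : ℂ)) * ((s : ℂ) + Complex.I)⁻¹) *
      sqrtRes T := by
    rw [sqrtRes, hT.opFun_mul h1 (Admissible.inv_one_add_sqrt b), hT.cayleyRes_eq, zero_mul]
    refine hT.opFun_congr fun s _ => ?_
    have := Admissible.one_add_sqrt_ne s
    field_simp
  have h3 : cayleyRes T x = 0 := by
    rw [h2]
    change opFun T 0 _ (sqrtRes T x) = 0
    rw [hx, map_zero]
  have h4 := hT.isResolventAt_of_im (z := -Complex.I) (by simp)
  exact h4.injective (neg_eq_zero.1 h3)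

lemma sqrtOp_graph : (sqrtOp T).graph = LinearMap.range
    ((sqrtRes T : H →ₗ[ℂ] H).prod ((1 - sqrtRes T : H →L[ℂ] H) : H →ₗ[ℂ] H)) := by
  have : sqrtOp T = (LinearMap.range
    ((sqrtRes T : H →ₗ[ℂ] H).prod
      ((1 - sqrtRes T : H →L[ℂ] H) : H →ₗ[ℂ] H))).toLinearPMap := by
    rw [← funcCalc_eq_sqrtRes]; rfl
  rw [this]
  refine Submodule.toLinearPMap_graph_eq _ ?_
  rintro ⟨x, y⟩ ⟨u, hu⟩ hx
  obtain ⟨h1, h2⟩ := Prod.ext_iff.1 hu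
  have h3 : sqrtRes T u = 0 := h1.trans hx
  have h4 := hT.sqrtRes_injective h3
  rw [← h2, h4, map_zero]
  rfl

lemma isBoundedProduct_sqrtRes : IsBoundedProduct (sqrtOp T) (sqrtRes T) (1 - sqrtRes T) := by
  intro x
  have h : (sqrtRes T x, (1 - sqrtRes T) x) ∈ (sqrtOp T).graph := by
    rw [hT.sqrtOp_graph]; exact ⟨x, rfl⟩
  obtain ⟨⟨u, hu⟩, h1, h2⟩ := (LinearPMap.mem_graph_iff _).1 h
  simp only at h1 h2
  subst h1
  exact ⟨hu, h2⟩

lemma exists_sqrtRes_eq (φ : formDomain T) : ∃ x, sqrtRes T x = φ ∧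
    sqrtOp T φ = (1 - sqrtRes T) x := by
  have h := LinearPMap.mem_graph (sqrtOp T) φ
  rw [hT.sqrtOp_graph] at h
  obtain ⟨x, hx⟩ := h
  obtain ⟨h1, h2⟩ := Prod.ext_iff.1 hx
  exact ⟨x, h1, h2.symm⟩

lemma inner_sqrtOp (φ ψ : formDomain T) :
    ⟪sqrtOp T φ, (ψ : H)⟫_ℂ = ⟪(φ : H), sqrtOp T ψ⟫_ℂ := by
  obtain ⟨x, h1, h2⟩ := hT.exists_sqrtRes_eq φ
  obtain ⟨y, h3, h4⟩ := hT.exists_sqrtRes_eq ψ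
  rw [h2, h4, ← h1, ← h3]
  change ⟪x - sqrtRes T x, sqrtRes T y⟫_ℂ = ⟪sqrtRes T x, y - sqrtRes T y⟫_ℂ
  rw [inner_sub_left, inner_sub_right, inner_sqrtRes T x y]

/-- A function `g` of `T + a` is the function `s ↦ g (s + a)` of `T`, by composition in the
functional calculus. -/
lemma opFun_addConst {a : ℝ} (hg : Admissible (b + a) c g) :
    opFun (FormDyson.addConst T a) c g = opFun T c fun s => g (s + a) := by
  have hTa := hT.addConst a
  have hz : ∀ s : ℝ, b ≤ s → (-Complex.I - a : ℂ) ≠ s := fun s _ h => by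
    have := congrArg Complex.im h
    simp at this
  have h1 := Admissible.inv_sub b hz
  have h2 := (Admissible.const b (-1)).mul h1
  -- the resolvent of `T + a` is a function of the resolvent of `T`
  have hN : cayleyRes (FormDyson.addConst T a) =
      cfc (calcFun 0 fun s => -1 * (-Complex.I - a - s : ℂ)⁻¹) (cayleyRes T) := by
    rw [cayleyRes, resolventOp_addConst, hT.resolventOp_eq hz, ← neg_one_smul ℂ,
      hT.opFun_smul _ h1, mul_zero]
    rfl
  rw [mul_zero] at h2
  have hn := hT.isStarNormal
  have hc2 := hT.continuousOn_calcFun h2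
  have hcont := hTa.continuousOn_calcFun hg
  rw [hN, cfc_map_spectrum _ (cayleyRes T) hn hc2] at hcont
  rw [opFun, opFun, hN, ← cfc_comp' _ _ _ hcont hc2 hn]
  refine cfc_congr fun w hw => ?_
  by_cases h0 : w = 0
  · simp [calcFun, h0]
  · obtain ⟨s, hs, e⟩ := hT.exists_of_mem_spectrum hw h0
    have h3 : (-1 * (-Complex.I - a - s : ℂ)⁻¹) = ((s + a : ℝ) + Complex.I : ℂ)⁻¹ := by
      rw [← inv_neg_one, ← mul_inv]; congr 1; push_cast; ring
    have h4 : ((s + a : ℝ) + Complex.I : ℂ) ≠ 0 := fun h => by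
      have := congrArg Complex.im h
      simp at this
    have h5 : calcFun 0 (fun s => -1 * (-Complex.I - a - s : ℂ)⁻¹) w =
        ((s + a : ℝ) + Complex.I : ℂ)⁻¹ := by
      simp only [calcFun]
      rw [if_neg h0, e, Complex.ofReal_re, h3]
    simp only [h5]
    simp only [calcFun]
    rw [if_neg (inv_ne_zero h4), if_neg h0, e, inv_inv, add_sub_cancel_right, Complex.ofReal_re,
      Complex.ofReal_re]

lemma heat_addConst (a : ℝ) {t : ℝ} (ht : 0 < t) :
    heat T t = Real.exp (t * a) • heat (FormDyson.addConst T a) t := by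
  rw [heat, heat, funcCalc_eq, funcCalc_eq, hT.opFun_addConst (Admissible.exp_neg_mul _ ht)]
  have h1 : Admissible b 0 fun s => Complex.exp (-((t * (s + a) : ℝ) : ℂ)) := by
    have := (Admissible.exp_neg_mul b ht).mul (Admissible.const b (Complex.exp (-(t * a))))
    rw [zero_mul] at this
    refine this.congr fun s _ => ?_
    rw [← Complex.exp_add]; congr 1; push_cast; ring
  have h2 := hT.opFun_smul (Real.exp (t * a) : ℂ) h1
  rw [Complex.coe_smul, mul_zero] at h2
  rw [h2]
  refine hT.opFun_congr fun s _ => ?_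
  rw [Complex.ofReal_exp, ← Complex.exp_add]; congr 1; push_cast; ring

/-- `√T g(T) = (s ↦ √s g(s))(T)`. -/
lemma isBoundedProduct_sqrtOp (hg : ContinuousOn g (Set.Ici b))
    (hsg : Tendsto (fun s : ℝ => (√s : ℂ) * g s) atTop (𝓝 c)) :
    IsBoundedProduct (sqrtOp T) (opFun T 0 g) (opFun T c fun s => √s * g s) := by
  have h0 : Admissible b 0 g := Admissible.of_mul hg Real.tendsto_sqrt_atTop hsg
  have h1 : Admissible b c fun s => (√s : ℂ) * g s :=
    ⟨(Complex.continuous_ofReal.comp Real.continuous_sqrt).continuousOn.mul hg, hsg⟩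
  have h2 : Admissible b c fun s => (1 + (√s : ℂ)) * g s := by
    have := h0.add h1
    rw [zero_add] at this
    exact this.congr fun s _ => by ring
  have e1 : opFun T 0 g = sqrtRes T * opFun T c fun s => (1 + (√s : ℂ)) * g s := by
    rw [sqrtRes, hT.opFun_mul (Admissible.inv_one_add_sqrt b) h2, zero_mul]
    refine hT.opFun_congr fun s _ => ?_
    have := Admissible.one_add_sqrt_ne s
    field_simp
  have e2 : (1 - sqrtRes T) * opFun T c (fun s => (1 + (√s : ℂ)) * g s) =
      opFun T c fun s => √s * g s := by
    rw [sub_mul, one_mul, ← e1, hT.opFun_sub h2 h0, sub_zero]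
    exact hT.opFun_congr fun s _ => by ring
  rw [e1, ← e2]
  exact hT.isBoundedProduct_sqrtRes.mul_right _

lemma dense_formDomain : Dense (formDomain T : Set H) := by
  refine hT.1.dense_domain.mono fun x hx => ?_
  have hz : ∀ s : ℝ, b ≤ s → -Complex.I ≠ s := fun s _ h => by
    have := congrArg Complex.im h
    simp at this
  obtain ⟨y, hy⟩ := (hT.isResolventAt hz).mem_range ⟨x, hx⟩
  rw [hT.resolventOp_eq hz] at hy
  obtain ⟨h, -⟩ := hT.isBoundedProduct_sqrtOp (Admissible.inv_sub b hz).1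
    (Admissible.sqrt_mul_inv_sub b hz).2 y
  rw [hy] at h
  exact h

lemma isBoundedProduct_sqrtOp_resolventOp {z : ℂ} (hz : ∀ s : ℝ, b ≤ s → z ≠ s) :
    IsBoundedProduct (sqrtOp T) (resolventOp T z) (opFun T 0 fun s => √s * (z - s)⁻¹) := by
  rw [hT.resolventOp_eq hz]
  exact hT.isBoundedProduct_sqrtOp (Admissible.inv_sub b hz).1 (Admissible.sqrt_mul_inv_sub b hz).2

end SelfAdjointGE

section Energy

variable {a : ℝ}

lemma continuousOn_sqrt_div (a b : ℝ) :
    ContinuousOn (fun s : ℝ => (√(s + a) : ℂ) * (1 + (√(s + b) : ℂ))⁻¹) (Set.Ici 0) := by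
  refine ContinuousOn.mul (by fun_prop) (ContinuousOn.inv₀ (by fun_prop) fun s _ => ?_)
  exact Admissible.one_add_sqrt_ne _

lemma abs_sqrt_add_sub_sqrt_le (ha : 0 ≤ a) {s : ℝ} (hs : 0 ≤ s) : |√(s + a) - √s| ≤ √a := by
  rw [abs_of_nonneg (sub_nonneg.2 (Real.sqrt_le_sqrt (by linarith))), sub_le_iff_le_add']
  refine Real.sqrt_le_iff.2 ⟨by positivity, ?_⟩
  have h1 := Real.sq_sqrt hs
  have h2 := Real.sq_sqrt ha
  have h3 : 0 ≤ √s * √a := by positivity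
  nlinarith

lemma admissible_sqrt_add_div (ha : 0 ≤ a) :
    Admissible 0 1 fun s : ℝ => (√(s + a) : ℂ) * (1 + (√s : ℂ))⁻¹ := by
  refine Admissible.of_norm_sub_one_le (M := √a + 1) ?_ fun s hs => ?_
  · simpa using continuousOn_sqrt_div a 0
  · have h0 : (0 : ℝ) < 1 + √s := by positivity
    have : ((√(s + a) : ℂ) * (1 + (√s : ℂ))⁻¹ - 1) =
        (((√(s + a) - √s - 1) * (1 + √s)⁻¹ : ℝ) : ℂ) := by
      have := Admissible.one_add_sqrt_ne s
      push_cast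
      field_simp
      ring
    rw [this, Complex.norm_real, Real.norm_eq_abs, abs_mul, abs_of_pos (inv_pos.2 h0)]
    gcongr
    refine (abs_sub _ _).trans ?_
    simpa using abs_sqrt_add_sub_sqrt_le ha hs

lemma admissible_sqrt_div_add (ha : 0 ≤ a) :
    Admissible 0 1 fun s : ℝ => (√s : ℂ) * (1 + (√(s + a) : ℂ))⁻¹ := by
  refine Admissible.of_norm_sub_one_le (M := √a + 1) ?_ fun s hs => ?_
  · simpa using continuousOn_sqrt_div 0 a
  · have h0 : (0 : ℝ) < 1 + √s := by positivity
    have h1 : (0 : ℝ) < 1 + √(s + a) := by positivity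
    have : ((√s : ℂ) * (1 + (√(s + a) : ℂ))⁻¹ - 1) =
        ((-(√(s + a) - √s + 1) * (1 + √(s + a))⁻¹ : ℝ) : ℂ) := by
      have := Admissible.one_add_sqrt_ne (s + a)
      push_cast
      field_simp
      ring
    rw [this, Complex.norm_real, Real.norm_eq_abs, abs_mul, abs_neg, abs_of_pos (inv_pos.2 h1)]
    have h2 : |√(s + a) - √s + 1| ≤ √a + 1 := by
      refine (abs_add_le _ _).trans ?_
      simpa using abs_sqrt_add_sub_sqrt_le ha hs
    have h3 : √s ≤ √(s + a) := Real.sqrt_le_sqrt (by linarith)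
    gcongr

variable (hT : SelfAdjointGE T 0)
include hT

/-- `√(T + a) (1 + √T)⁻¹ = (s ↦ √(s + a) / (1 + √s))(T)`, by a computation in the functional
calculus of `T + a`. -/
lemma isBoundedProduct_sqrtOp_addConst (ha : 0 ≤ a) :
    IsBoundedProduct (sqrtOp (addConst T a)) (sqrtRes T)
      (opFun T 1 fun s => √(s + a) * (1 + (√s : ℂ))⁻¹) := by
  have hTa := hT.addConst a
  rw [zero_add] at hTa
  have h1 := admissible_sqrt_add_div ha
  have hshift : ContinuousOn (fun s : ℝ => s - a) (Set.Ici a) := by fun_prop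
  have hmaps : Set.MapsTo (fun s : ℝ => s - a) (Set.Ici a) (Set.Ici 0) := fun s hs => by
    simpa using hs
  have hlim : Tendsto (fun s : ℝ => s - a) atTop atTop :=
    tendsto_atTop_add_const_right _ _ tendsto_id
  have h2 : Admissible a 0 fun s : ℝ => (1 + (√(s - a) : ℂ))⁻¹ :=
    ⟨(Admissible.inv_one_add_sqrt 0).1.comp hshift hmaps,
      (Admissible.inv_one_add_sqrt 0).2.comp hlim⟩
  have h3 : Admissible a 1 fun s : ℝ => (√s : ℂ) * (1 + (√(s - a) : ℂ))⁻¹ := by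
    have : Admissible a 1 ((fun s : ℝ => (√(s + a) : ℂ) * (1 + (√s : ℂ))⁻¹) ∘ fun s => s - a) :=
      ⟨h1.1.comp hshift hmaps, h1.2.comp hlim⟩
    exact this.congr fun s _ => by simp
  have := hTa.isBoundedProduct_sqrtOp h2.1 h3.2
  rw [hT.opFun_addConst (by rwa [zero_add]), hT.opFun_addConst (by rwa [zero_add])] at this
  simpa [sqrtRes] using this

/-- Both `√(s + a) / (1 + √s)` and `√s / (1 + √(s + a))` have a limit at infinity. -/
lemma mem_formDomain_addConst (ha : 0 ≤ a) {φ : H} :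
    φ ∈ formDomain (addConst T a) ↔ φ ∈ formDomain T := by
  constructor
  · intro h
    have hTa := hT.addConst a
    rw [zero_add] at hTa
    obtain ⟨x, hx, -⟩ := hTa.exists_sqrtRes_eq ⟨φ, h⟩
    have h1 := admissible_sqrt_div_add ha
    have h2 : Admissible 0 0 fun s : ℝ => (1 + (√(s + a) : ℂ))⁻¹ := by
      refine Admissible.of_mul ?_ Real.tendsto_sqrt_atTop h1.2
      refine ContinuousOn.inv₀ (by fun_prop) fun s _ => ?_
      exact Admissible.one_add_sqrt_ne _
    obtain ⟨h3, -⟩ := hT.isBoundedProduct_sqrtOp h2.1 h1.2 x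
    have h4 : sqrtRes (addConst T a) = opFun T 0 fun s : ℝ => (1 + (√(s + a) : ℂ))⁻¹ := by
      rw [sqrtRes, hT.opFun_addConst (Admissible.inv_one_add_sqrt _)]
    rw [← h4, hx] at h3
    exact h3
  · intro h
    obtain ⟨x, hx, -⟩ := hT.exists_sqrtRes_eq ⟨φ, h⟩
    obtain ⟨h3, -⟩ := isBoundedProduct_sqrtOp_addConst hT ha x
    rw [hx] at h3
    exact h3

/-- `⟨√(T + a) φ|√(T + a) ψ⟩ = ⟨√T φ|√T ψ⟩ + a ⟨φ|ψ⟩`. -/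
lemma inner_sqrtOp_addConst (ha : 0 ≤ a) (φ ψ : formDomain T)
    (hφ : (φ : H) ∈ formDomain (addConst T a)) (hψ : (ψ : H) ∈ formDomain (addConst T a)) :
    ⟪sqrtOp (addConst T a) ⟨φ, hφ⟩, sqrtOp (addConst T a) ⟨ψ, hψ⟩⟫_ℂ =
      energyForm T φ ψ + a * ⟪(φ : H), (ψ : H)⟫_ℂ := by
  obtain ⟨x, hx, h1⟩ := hT.exists_sqrtRes_eq φ
  obtain ⟨y, hy, h2⟩ := hT.exists_sqrtRes_eq ψ
  set K := opFun T 1 fun s => √(s + a) * (1 + (√s : ℂ))⁻¹ with hK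
  have hP := isBoundedProduct_sqrtOp_addConst hT ha
  have e1 : sqrtOp (addConst T a) ⟨φ, hφ⟩ = K x := by
    obtain ⟨h, e⟩ := hP x
    have : (⟨φ, hφ⟩ : formDomain (addConst T a)) = ⟨sqrtRes T x, h⟩ := Subtype.ext hx.symm
    rw [this, e]
  have e2 : sqrtOp (addConst T a) ⟨ψ, hψ⟩ = K y := by
    obtain ⟨h, e⟩ := hP y
    have : (⟨ψ, hψ⟩ : formDomain (addConst T a)) = ⟨sqrtRes T y, h⟩ := Subtype.ext hy.symm
    rw [this, e]
  have hKs : star K = K := by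
    rw [hK, star_opFun]; simp
  have hA := admissible_sqrt_add_div ha
  have hG := Admissible.inv_one_add_sqrt 0
  have h1G : 1 - sqrtRes T = opFun T 1 fun s => 1 - (1 + (√s : ℂ))⁻¹ := by
    rw [sqrtRes, ← hT.opFun_one, hT.opFun_sub (Admissible.const 0 1) hG, sub_zero]
  have h1A : Admissible 0 1 fun s => 1 - (1 + (√s : ℂ))⁻¹ := by
    simpa using (Admissible.const 0 1).sub hG
  have hGs := star_sqrtRes T
  have key : star K * K = star (1 - sqrtRes T) * (1 - sqrtRes T) +
      (a : ℂ) • (star (sqrtRes T) * sqrtRes T) := by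
    rw [hKs, star_sub, star_one, hGs, h1G, hK, hT.opFun_mul hA hA, hT.opFun_mul h1A h1A, sqrtRes,
      hT.opFun_mul hG hG, hT.opFun_smul _ (hG.mul hG),
      hT.opFun_add (h1A.mul h1A) ((Admissible.const 0 (a : ℂ)).mul (hG.mul hG))]
    have : (1 * 1 + (a : ℂ) * (0 * 0)) = 1 * 1 := by ring
    rw [this]
    refine hT.opFun_congr fun s hs => ?_
    have h0 := Admissible.one_add_sqrt_ne s
    have h3 : (√(s + a) : ℂ) * √(s + a) = √s * √s + a := by
      rw [← Complex.ofReal_mul, ← Complex.ofReal_mul, Real.mul_self_sqrt hs,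
        Real.mul_self_sqrt (by linarith)]
      push_cast; rfl
    field_simp
    linear_combination h3
  have inner_eq : ∀ X : H →L[ℂ] H, ⟪X x, X y⟫_ℂ = ⟪x, (star X * X) y⟫_ℂ := fun X => by
    rw [ContinuousLinearMap.star_eq_adjoint]
    exact (ContinuousLinearMap.adjoint_inner_right X x (X y)).symm
  rw [e1, e2, energyForm, h1, h2, ← hx, ← hy, inner_eq, inner_eq, inner_eq, key]
  change ⟪x, (star (1 - sqrtRes T) * (1 - sqrtRes T)) y +
      (a : ℂ) • (star (sqrtRes T) * sqrtRes T) y⟫_ℂ = _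
  rw [inner_add_right, inner_smul_right]

end Energy

end Complete

end Operators

/-! ### Contour integrals around the half-line -/

section Contour

variable {E : Type*} [NormedAddCommGroup E] [NormedSpace ℂ E]

/-- The complex plane cut along the half-line `[0, ∞)`. -/
def cutPlane : Set ℂ := {z | ∀ s : ℝ, 0 ≤ s → z ≠ s}

lemma mem_cutPlane_iff {z : ℂ} : z ∈ cutPlane ↔ -z ∈ Complex.slitPlane := by
  rw [Complex.mem_slitPlane_iff]
  constructor
  · intro h
    by_contra hcon
    push Not at hcon
    simp only [Complex.neg_re, Complex.neg_im] at hcon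
    exact h z.re (by linarith [hcon.1]) (Complex.ext (by simp) (by simpa using hcon.2))
  · rintro h s hs rfl
    simp at h
    linarith

lemma isOpen_cutPlane : IsOpen cutPlane := by
  have : cutPlane = (fun z : ℂ => -z) ⁻¹' Complex.slitPlane := Set.ext fun z => mem_cutPlane_iff
  rw [this]
  exact Complex.isOpen_slitPlane.preimage continuous_neg

/-- A holomorphic function on the cut plane has a primitive: in the variable `w = log (-z)` the
cut plane is a convex strip. -/
lemma exists_primitive [CompleteSpace E] {f : ℂ → E} (hf : DifferentiableOn ℂ f cutPlane) :
    ∃ F : ℂ → E, ∀ z ∈ cutPlane, HasDerivAt F (f z) z := by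
  set s : Set ℂ := {w | -Real.pi < w.im ∧ w.im < Real.pi} with hs
  have hso : IsOpen s := (isOpen_lt continuous_const Complex.continuous_im).inter
    (isOpen_lt Complex.continuous_im continuous_const)
  have hsc : Convex ℝ s := by
    have : s = Complex.imLm ⁻¹' Set.Ioo (-Real.pi) Real.pi := rfl
    rw [this]
    exact (convex_Ioo _ _).linear_preimage Complex.imLm
  have hmaps : ∀ w ∈ s, -Complex.exp w ∈ cutPlane := by
    intro w hw
    rw [mem_cutPlane_iff, neg_neg, Complex.mem_slitPlane_iff]
    by_contra hcon
    push Not at hcon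
    have hlog := Complex.log_exp hw.1 hw.2.le
    have harg : (Complex.exp w).arg = w.im := by
      rw [← Complex.log_im, hlog]
    have hlt : (Complex.exp w).re < 0 := by
      refine lt_of_le_of_ne hcon.1 fun h => ?_
      exact Complex.exp_ne_zero w (Complex.ext h hcon.2)
    have := Complex.arg_eq_pi_iff.2 ⟨hlt, hcon.2⟩
    rw [harg] at this
    exact hw.2.ne this
  have hg : DifferentiableOn ℂ (fun w => (-Complex.exp w) • -(-f (-Complex.exp w))) s := by
    intro w hw
    have h1 : DifferentiableAt ℂ f (-Complex.exp w) :=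
      (hf _ (hmaps w hw)).differentiableAt (isOpen_cutPlane.mem_nhds (hmaps w hw))
    have h2 : DifferentiableAt ℂ (fun w => -Complex.exp w) w := by fun_prop
    simp only [neg_neg]
    exact (h2.smul (h1.comp w h2)).differentiableWithinAt
  obtain ⟨G, hG⟩ := hsc.exists_forall_hasDerivWithinAt hg
  refine ⟨fun z => G (Complex.log (-z)), fun z hz => ?_⟩
  have hz' := mem_cutPlane_iff.1 hz
  have hz0 : -z ≠ 0 := Complex.slitPlane_ne_zero hz'
  have hw : Complex.log (-z) ∈ s := by
    refine ⟨Complex.neg_pi_lt_log_im _, lt_of_le_of_ne (Complex.log_im_le_pi _) fun h => ?_⟩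
    rw [Complex.log_im] at h
    exact (Complex.mem_slitPlane_iff_arg.1 hz').1 h
  have h1 := (hG _ hw).hasDerivAt (hso.mem_nhds hw)
  have h2 : HasDerivAt (fun z : ℂ => Complex.log (-z)) ((-z)⁻¹ * -1) z := by
    have := (Complex.hasStrictDerivAt_log hz').hasDerivAt
    exact this.comp z (hasDerivAt_neg z)
  have h3 := h1.scomp z h2
  rw [Complex.exp_log hz0] at h3
  simp only [neg_neg, smul_smul] at h3
  have h4 : (-z)⁻¹ * -1 * z = 1 := by
    have : z ≠ 0 := neg_ne_zero.1 hz0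
    field_simp
  rwa [h4, one_smul] at h3

variable {γ κ : ℝ}

lemma contour_re (γ κ u : ℝ) : (contour γ κ u).re = -κ + γ * |u| := by
  simp [contour]

lemma contour_im (γ κ u : ℝ) : (contour γ κ u).im = -u := by
  simp [contour]

@[fun_prop]
lemma continuous_contour (γ κ : ℝ) : Continuous (contour γ κ) := by
  unfold contour
  fun_prop

lemma contour_mem_cutPlane (hκ : 0 < κ) (u : ℝ) : contour γ κ u ∈ cutPlane := by
  intro s hs h
  have h1 := congrArg Complex.im h
  have h2 := congrArg Complex.re h
  rw [contour_im, Complex.ofReal_im, neg_eq_zero] at h1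
  rw [contour_re, Complex.ofReal_re, h1] at h2
  simp at h2
  linarith

lemma hasDerivAt_contour (γ κ : ℝ) {u : ℝ} (hu : u ≠ 0) :
    HasDerivAt (contour γ κ) (contourDeriv γ u) u := by
  have h1 : HasDerivAt (fun u : ℝ => -κ + γ * |u|) (γ * Real.sign u) u := by
    have h : HasDerivAt (fun u : ℝ => |u|) (Real.sign u) u := by
      rcases lt_or_gt_of_ne hu with h | h
      · rw [Real.sign_of_neg h]; exact hasDerivAt_abs_neg h
      · rw [Real.sign_of_pos h]; exact hasDerivAt_abs_pos h
    exact (h.const_mul γ).const_add _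
  have h2 : HasDerivAt (fun u : ℝ => (u : ℂ) * Complex.I) (1 * Complex.I) u :=
    (Complex.ofRealCLM.hasDerivAt (x := u)).mul_const _
  rw [one_mul] at h2
  exact h1.ofReal_comp.sub h2

lemma measurable_contourDeriv (γ : ℝ) : Measurable (contourDeriv γ) := by
  have h : Measurable Real.sign := by
    unfold Real.sign
    exact Measurable.ite measurableSet_Iio measurable_const
      (Measurable.ite measurableSet_Ioi measurable_const measurable_const)
  unfold contourDeriv
  fun_prop

lemma norm_contourDeriv_le (γ u : ℝ) : ‖contourDeriv γ u‖ ≤ √(1 + γ ^ 2) := by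
  rw [Complex.norm_def]
  refine Real.sqrt_le_sqrt ?_
  have : (Real.sign u) ^ 2 ≤ 1 := by
    rcases Real.sign_apply_eq u with h | h | h <;> rw [h] <;> norm_num
  simp only [contourDeriv, Complex.normSq_apply, Complex.sub_re, Complex.sub_im,
    Complex.ofReal_re, Complex.ofReal_im, Complex.I_re, Complex.I_im]
  nlinarith [sq_nonneg γ]

lemma integrable_exp_neg_abs {c : ℝ} (hc : 0 < c) :
    MeasureTheory.Integrable fun u : ℝ => Real.exp (-(c * |u|)) := by
  rw [← MeasureTheory.integrableOn_univ, ← Set.Iic_union_Ioi (a := (0 : ℝ))]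
  refine MeasureTheory.IntegrableOn.union ?_ ?_
  · refine (integrableOn_exp_mul_Iic hc 0).congr_fun (fun u hu => ?_) measurableSet_Iic
    simp only
    rw [abs_of_nonpos hu]; congr 1; ring
  · refine (integrableOn_exp_mul_Ioi (a := -c) (by linarith) 0).congr_fun (fun u hu => ?_)
      measurableSet_Ioi
    simp only
    rw [abs_of_pos hu]; congr 1; ring

lemma integral_exp_neg_abs {c : ℝ} (hc : 0 < c) :
    ∫ u : ℝ, Real.exp (-(c * |u|)) = 2 / c := by
  have h := integral_comp_abs (f := fun u => Real.exp (-(c * u)))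
  rw [h]
  have := integral_exp_mul_Ioi (a := -c) (by linarith) 0
  simp only [neg_mul] at this
  rw [this]
  simp; ring

/-- The bound `‖f z‖ ≤ M exp (-t Re z)` in the complement of every sector around `[0, ∞)` with
vertex on the negative half-line. -/
def SectorBound (f : ℂ → E) (t : ℝ) : Prop :=
  ∀ γ : ℝ, 0 < γ → ∀ κ : ℝ, 0 < κ → ∃ M : ℝ, ∀ z : ℂ, z.re ≤ -κ + γ * |z.im| →
    ‖f z‖ ≤ M * Real.exp (-(t * z.re))

lemma aestronglyMeasurable_contour {f : ℂ → E} (hf : ContinuousOn f cutPlane) (hκ : 0 < κ) :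
    MeasureTheory.AEStronglyMeasurable fun u : ℝ => contourDeriv γ u • f (contour γ κ u) := by
  refine (measurable_contourDeriv γ).aestronglyMeasurable.smul ?_
  exact (hf.comp_continuous (continuous_contour γ κ)
    (contour_mem_cutPlane hκ)).aestronglyMeasurable

lemma norm_contourDeriv_smul_le {f : ℂ → E} {t M u : ℝ}
    (h : ‖f (contour γ κ u)‖ ≤ M * Real.exp (-(t * (contour γ κ u).re))) :
    ‖contourDeriv γ u • f (contour γ κ u)‖ ≤
      √(1 + γ ^ 2) * (M * Real.exp (t * κ)) * Real.exp (-(t * γ * |u|)) := by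
  rw [norm_smul]
  have h1 : Real.exp (-(t * (contour γ κ u).re)) =
      Real.exp (t * κ) * Real.exp (-(t * γ * |u|)) := by
    rw [contour_re, ← Real.exp_add]; congr 1; ring
  rw [h1] at h
  calc _ ≤ √(1 + γ ^ 2) * (M * (Real.exp (t * κ) * Real.exp (-(t * γ * |u|)))) :=
        mul_le_mul (norm_contourDeriv_le γ u) h (norm_nonneg _) (Real.sqrt_nonneg _)
    _ = _ := by ring

lemma integrable_contour {f : ℂ → E} (hf : ContinuousOn f cutPlane) {t : ℝ} (ht : 0 < t)
    (hb : SectorBound f t) (hγ : 0 < γ) (hκ : 0 < κ) :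
    MeasureTheory.Integrable fun u : ℝ => contourDeriv γ u • f (contour γ κ u) := by
  obtain ⟨M, hM⟩ := hb γ hγ κ hκ
  refine ((integrable_exp_neg_abs (mul_pos ht hγ)).const_mul
    (√(1 + γ ^ 2) * (M * Real.exp (t * κ)))).mono'
    (aestronglyMeasurable_contour hf hκ) (Eventually.of_forall fun u => ?_)
  refine norm_contourDeriv_smul_le (hM _ ?_)
  rw [contour_re, contour_im, abs_neg]

/-- A contour integral as a limit of increments of a primitive. -/
lemma tendsto_primitive [CompleteSpace E] {f F : ℂ → E} (hF : ∀ z ∈ cutPlane, HasDerivAt F (f z) z)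
    (hκ : 0 < κ)
    (hi : MeasureTheory.Integrable fun u : ℝ => contourDeriv γ u • f (contour γ κ u)) :
    Tendsto (fun N : ℝ => F (contour γ κ N) - F (contour γ κ (-N))) atTop
      (𝓝 (∫ u : ℝ, contourDeriv γ u • f (contour γ κ u))) := by
  refine (MeasureTheory.intervalIntegral_tendsto_integral hi tendsto_neg_atTop_atBot
    tendsto_id).congr fun N => ?_
  refine MeasureTheory.integral_eq_of_hasDerivAt_off_countable (fun u => F (contour γ κ u)) _
    (Set.countable_singleton 0) ?_ ?_ hi.intervalIntegrable
  · refine Continuous.continuousOn (continuous_iff_continuousAt.2 fun u => ?_)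
    exact (hF _ (contour_mem_cutPlane hκ u)).continuousAt.comp (continuous_contour γ κ).continuousAt
  · intro u hu
    exact (hF _ (contour_mem_cutPlane hκ u)).scomp u (hasDerivAt_contour γ κ hu.2)

lemma tendsto_mul_exp_neg {c : ℝ} (hc : 0 < c) (A B : ℝ) :
    Tendsto (fun N : ℝ => (A + B * N) * Real.exp (-(c * N))) atTop (𝓝 0) := by
  have hcN : Tendsto (fun N : ℝ => c * N) atTop atTop := tendsto_id.const_mul_atTop hc
  have h0 := (Real.tendsto_exp_neg_atTop_nhds_zero.comp hcN).const_mul A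
  have h1 := ((Real.tendsto_pow_mul_exp_neg_atTop_nhds_zero 1).comp hcN).const_mul (B / c)
  have := h0.add h1
  simp only [mul_zero, add_zero] at this
  refine this.congr fun N => ?_
  simp only [Function.comp_apply, pow_one]
  field_simp

/-- The integral of a holomorphic function over the contour does not depend on the contour. -/
lemma integral_contour_eq [CompleteSpace E] {f : ℂ → E} (hf : DifferentiableOn ℂ f cutPlane) {t : ℝ}
    (ht : 0 < t) (hb : SectorBound f t) {γ' κ' : ℝ} (hγ : 0 < γ) (hκ : 0 < κ) (hγ' : 0 < γ')
    (hκ' : 0 < κ') :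
    ∫ u : ℝ, contourDeriv γ u • f (contour γ κ u) =
      ∫ u : ℝ, contourDeriv γ' u • f (contour γ' κ' u) := by
  obtain ⟨F, hF⟩ := exists_primitive hf
  have h1 := tendsto_primitive hF hκ (integrable_contour hf.continuousOn ht hb hγ hκ)
  have h2 := tendsto_primitive hF hκ' (integrable_contour hf.continuousOn ht hb hγ' hκ')
  obtain ⟨M, hM⟩ := hb (max γ γ') (lt_max_of_lt_left hγ) (min κ κ') (lt_min hκ hκ')
  have hg : 0 < min γ γ' := lt_min hγ hγ'
  -- the two contours are joined by horizontal segments that run off to infinity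
  have key : ∀ u : ℝ, u ≠ 0 → ‖F (contour γ κ u) - F (contour γ' κ' u)‖ ≤
      |M| * Real.exp (t * max κ κ') * ((|κ - κ'| + |γ - γ'| * |u|) *
        Real.exp (-(t * min γ γ' * |u|))) := by
    intro u hu
    have hu' := abs_nonneg u
    set S : Set ℂ := {z | z.im = -u ∧ -max κ κ' + min γ γ' * |u| ≤ z.re ∧
      z.re ≤ -min κ κ' + max γ γ' * |u|} with hS
    have hSc : Convex ℝ S := by
      have : S = Complex.imLm ⁻¹' {-u} ∩ Complex.reLm ⁻¹'
        Set.Icc (-max κ κ' + min γ γ' * |u|) (-min κ κ' + max γ γ' * |u|) := rfl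
      rw [this]
      exact ((convex_singleton _).linear_preimage _).inter ((convex_Icc _ _).linear_preimage _)
    have hSU : ∀ z ∈ S, z ∈ cutPlane := by
      rintro z hz s hs rfl
      have := hz.1
      simp at this
      exact hu this
    have hbound : ∀ z ∈ S, ‖f z‖ ≤ |M| * (Real.exp (t * max κ κ') *
        Real.exp (-(t * min γ γ' * |u|))) := by
      intro z hz
      have h3 := hM z (by rw [hz.1, abs_neg]; exact hz.2.2)
      refine h3.trans ?_
      rw [← Real.exp_add]
      refine mul_le_mul (le_abs_self M) (Real.exp_le_exp.2 ?_) (Real.exp_pos _).le (abs_nonneg _)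
      nlinarith [mul_le_mul_of_nonneg_left hz.2.1 ht.le]
    have m1 : contour γ κ u ∈ S := by
      refine ⟨contour_im _ _ _, ?_, ?_⟩ <;> rw [contour_re] <;> gcongr <;> simp
    have m2 : contour γ' κ' u ∈ S := by
      refine ⟨contour_im _ _ _, ?_, ?_⟩ <;> rw [contour_re] <;> gcongr <;> simp
    have h4 := hSc.norm_image_sub_le_of_norm_hasDerivWithin_le
      (fun z hz => (hF z (hSU z hz)).hasDerivWithinAt) hbound m2 m1
    have h5 : ‖contour γ κ u - contour γ' κ' u‖ ≤ |κ - κ'| + |γ - γ'| * |u| := by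
      have : contour γ κ u - contour γ' κ' u = (((κ' - κ) + (γ - γ') * |u| : ℝ) : ℂ) := by
        simp only [contour]; push_cast; ring
      rw [this, Complex.norm_real, Real.norm_eq_abs]
      refine (abs_add_le _ _).trans ?_
      rw [abs_sub_comm κ' κ, abs_mul, abs_abs]
    refine h4.trans ?_
    calc _ ≤ |M| * (Real.exp (t * max κ κ') * Real.exp (-(t * min γ γ' * |u|))) *
          (|κ - κ'| + |γ - γ'| * |u|) := by gcongr
      _ = _ := by ring
  have hlim := (tendsto_mul_exp_neg (mul_pos ht hg) |κ - κ'| |γ - γ'|).const_mul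
    (|M| * Real.exp (t * max κ κ'))
  rw [mul_zero] at hlim
  have h3 : Tendsto (fun N : ℝ => F (contour γ κ N) - F (contour γ' κ' N)) atTop (𝓝 0) := by
    refine squeeze_zero_norm' ?_ hlim
    filter_upwards [eventually_gt_atTop 0] with N hN
    have := key N hN.ne'
    rwa [abs_of_pos hN] at this
  have h4 : Tendsto (fun N : ℝ => F (contour γ κ (-N)) - F (contour γ' κ' (-N))) atTop (𝓝 0) := by
    refine squeeze_zero_norm' ?_ hlim
    filter_upwards [eventually_gt_atTop 0] with N hN
    have := key (-N) (neg_ne_zero.2 hN.ne')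
    rwa [abs_neg, abs_of_pos hN] at this
  have h5 := (h1.sub h2).sub (h3.sub h4)
  rw [sub_zero, sub_zero] at h5
  have h6 : (∫ u : ℝ, contourDeriv γ u • f (contour γ κ u)) -
      ∫ u : ℝ, contourDeriv γ' u • f (contour γ' κ' u) = 0 := by
    refine tendsto_nhds_unique h5 (tendsto_const_nhds.congr fun N => ?_)
    abel
  exact sub_eq_zero.1 h6

end Contour

/-! ### The heat operator as a contour integral -/

section Cauchy

variable {γ κ t : ℝ}

lemma mem_cutPlane_of_re_le (hκ : 0 < κ) {z : ℂ} (hz : z.re ≤ -κ + γ * |z.im|) :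
    z ∈ cutPlane := by
  rintro s hs rfl
  simp at hz
  linarith

/-- The distance of `s ≥ 0` to the complement of a sector with vertex `-κ`. -/
lemma add_le_mul_norm_sub (γ κ : ℝ) {z : ℂ} (hz : z.re ≤ -κ + γ * |z.im|) (s : ℝ) :
    s + κ ≤ √(1 + γ ^ 2) * ‖z - s‖ := by
  have h1 : s + κ ≤ (s - z.re) + γ * |z.im| := by linarith
  refine h1.trans ?_
  rw [Complex.norm_def, ← Real.sqrt_mul (by positivity)]
  refine Real.le_sqrt_of_sq_le ?_
  simp only [Complex.normSq_apply, Complex.sub_re, Complex.sub_im, Complex.ofReal_re,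
    Complex.ofReal_im, sub_zero]
  have h2 : |z.im| ^ 2 = z.im ^ 2 := sq_abs _
  nlinarith [sq_nonneg (|z.im| - γ * (s - z.re))]

lemma norm_inv_sub_le (γ : ℝ) (hκ : 0 < κ) {z : ℂ} (hz : z.re ≤ -κ + γ * |z.im|) {s : ℝ}
    (hs : 0 ≤ s) : ‖(z - s)⁻¹‖ ≤ √(1 + γ ^ 2) / (s + κ) := by
  have h := add_le_mul_norm_sub γ κ hz s
  have h0 : 0 < ‖z - s‖ := norm_pos_iff.2 (sub_ne_zero.2 (mem_cutPlane_of_re_le hκ hz s hs))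
  rw [norm_inv, le_div_iff₀ (by linarith), inv_mul_le_iff₀ h0]
  linarith

lemma norm_exp_neg_mul (t : ℝ) (z : ℂ) : ‖Complex.exp (-(t * z))‖ = Real.exp (-(t * z.re)) := by
  rw [Complex.norm_exp]; simp

lemma sectorBound_inv {s : ℝ} (hs : 0 ≤ s) :
    SectorBound (fun z : ℂ => Complex.exp (-(t * z)) * (z - s)⁻¹) t := by
  intro γ hγ κ hκ
  refine ⟨√(1 + γ ^ 2) / (s + κ), fun z hz => ?_⟩
  rw [norm_mul, norm_exp_neg_mul, mul_comm]
  gcongr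
  exact norm_inv_sub_le γ hκ hz hs

lemma differentiableOn_exp_mul_inv {s : ℝ} (hs : 0 ≤ s) :
    DifferentiableOn ℂ (fun z : ℂ => Complex.exp (-(t * z)) * (z - s)⁻¹) cutPlane := by
  refine DifferentiableOn.mul (by fun_prop) ?_
  exact DifferentiableOn.inv (by fun_prop) fun z hz => sub_ne_zero.2 (hz s hs)

/-- Cauchy's formula for the contour around the half-line. The primitives
`E(z) + e^{-ts} log (s - z)` on the cut plane and `E(z) + e^{-ts} log (z - s)` on the half-plane
`Re z > s` of the integrand, with an entire function `E`, differ by `± π i e^{-ts}`. -/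
lemma integral_contour_exp (ht : 0 < t) (hγ : 0 < γ) (hκ : 0 < κ) {s : ℝ} (hs : 0 ≤ s) :
    ∫ u : ℝ, contourDeriv γ u • (Complex.exp (-(t * contour γ κ u)) * (contour γ κ u - s)⁻¹) =
      2 * Real.pi * Complex.I * Complex.exp (-((t * s : ℝ) : ℂ)) := by
  set f : ℂ → ℂ := fun z => Complex.exp (-(t * z)) * (z - s)⁻¹ with hf
  set e : ℂ := Complex.exp (-((t * s : ℝ) : ℂ)) with he
  have hd : DifferentiableOn ℂ (dslope (fun z : ℂ => Complex.exp (-(t * z))) s) Set.univ :=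
    (Complex.differentiableOn_dslope univ_mem).2 (by fun_prop)
  obtain ⟨G, hG⟩ := convex_univ.exists_forall_hasDerivWithinAt hd
  have hG' : ∀ z : ℂ, z ≠ s → HasDerivAt G ((Complex.exp (-(t * z)) - e) * (z - s)⁻¹) z := by
    intro z hz
    have h1 := (hG z trivial).hasDerivAt univ_mem
    rw [dslope_of_ne _ hz, slope_def_field, div_eq_mul_inv] at h1
    rw [he]
    push_cast
    exact h1
  have hF : ∀ z ∈ cutPlane, HasDerivAt (fun z => G z + e * Complex.log (s - z)) (f z) z := by
    intro z hz
    have hzs := hz s hs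
    have hsl : (s - z : ℂ) ∈ Complex.slitPlane := by
      rw [← neg_sub, ← mem_cutPlane_iff]
      intro r hr h
      exact hz (r + s) (by linarith) (by push_cast; linear_combination h)
    have h1 := (Complex.hasStrictDerivAt_log hsl).hasDerivAt.comp z
      ((hasDerivAt_id z).const_sub (s : ℂ))
    have h2 := (hG' z hzs).add (h1.const_mul e)
    refine h2.congr_deriv ?_
    have h3 : (s - z : ℂ)⁻¹ = -(z - s)⁻¹ := by rw [← neg_sub z, inv_neg]
    rw [hf, h3]; ring
  have hF₂ : ∀ z : ℂ, s < z.re →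
      HasDerivAt (fun z => G z + e * Complex.log (z - s)) (f z) z := by
    intro z hz
    have hzs : z ≠ s := by rintro rfl; simp at hz
    have hsl : (z - s : ℂ) ∈ Complex.slitPlane := by
      rw [Complex.mem_slitPlane_iff]; left; simpa using hz
    have h1 := (Complex.hasStrictDerivAt_log hsl).hasDerivAt.comp z
      ((hasDerivAt_id z).sub_const (s : ℂ))
    have h2 := (hG' z hzs).add (h1.const_mul e)
    refine h2.congr_deriv ?_
    rw [hf]; ring
  have hlim := tendsto_primitive hF hκ (integrable_contour (γ := γ)
    (differentiableOn_exp_mul_inv hs).continuousOn ht (sectorBound_inv hs) hγ hκ)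
  refine tendsto_nhds_unique hlim ?_
  -- the increment of the second primitive along the vertical segment that closes the contour
  have hbig : ∀ᶠ N : ℝ in atTop, s + 1 ≤ -κ + γ * N ∧ 0 < N :=
    ((tendsto_atTop_add_const_left atTop (-κ)
      (tendsto_id.const_mul_atTop hγ)).eventually_ge_atTop (s + 1)).and (eventually_gt_atTop 0)
  have h1 : Tendsto (fun N : ℝ => (G (contour γ κ N) + e * Complex.log (contour γ κ N - s)) -
      (G (contour γ κ (-N)) + e * Complex.log (contour γ κ (-N) - s))) atTop (𝓝 0) := by
    have hz := (tendsto_mul_exp_neg (mul_pos ht hγ) 0 2).const_mul (Real.exp (t * κ))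
    rw [mul_zero] at hz
    refine squeeze_zero_norm' ?_ hz
    filter_upwards [hbig] with N ⟨hN, hN0⟩
    set S : Set ℂ := {z | z.re = -κ + γ * N} with hS
    have hSc : Convex ℝ S := by
      have : S = Complex.reLm ⁻¹' {-κ + γ * N} := rfl
      rw [this]
      exact (convex_singleton _).linear_preimage _
    have hbound : ∀ z ∈ S, ‖f z‖ ≤ Real.exp (t * κ) * Real.exp (-(t * γ * N)) := by
      intro z hz
      have hz' : z.re = -κ + γ * N := hz
      rw [hf]
      simp only
      rw [norm_mul, norm_exp_neg_mul, hz', ← Real.exp_add, norm_inv]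
      have h3 : 1 ≤ ‖z - s‖ := by
        refine le_trans ?_ (Complex.re_le_norm _)
        simp only [Complex.sub_re, Complex.ofReal_re]
        linarith
      have h4 : ‖z - s‖⁻¹ ≤ 1 := inv_le_one_of_one_le₀ h3
      have h5 : -(t * (-κ + γ * N)) = t * κ + -(t * γ * N) := by ring
      rw [h5]
      exact mul_le_of_le_one_right (Real.exp_pos _).le h4
    have m1 : contour γ κ N ∈ S := by
      rw [hS, Set.mem_ofPred_eq, contour_re, abs_of_pos hN0]
    have m2 : contour γ κ (-N) ∈ S := by
      rw [hS, Set.mem_ofPred_eq, contour_re, abs_neg, abs_of_pos hN0]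
    have h4 := hSc.norm_image_sub_le_of_norm_hasDerivWithin_le
      (fun z hz => (hF₂ z (by rw [show z.re = _ from hz]; linarith)).hasDerivWithinAt) hbound m2 m1
    refine h4.trans (le_of_eq ?_)
    have h5 : contour γ κ N - contour γ κ (-N) = ((2 * N : ℝ) : ℂ) * -Complex.I := by
      simp only [contour, abs_neg]; push_cast; ring
    rw [h5, norm_mul, Complex.norm_real, norm_neg, Complex.norm_I, Real.norm_eq_abs,
      abs_of_pos (by linarith)]
    ring
  have h2 := h1.add (tendsto_const_nhds (x := 2 * Real.pi * Complex.I * e))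
  rw [zero_add] at h2
  refine h2.congr' ?_
  filter_upwards [hbig] with N ⟨hN, hN0⟩
  have l1 : Complex.log (s - contour γ κ N) =
      Complex.log (contour γ κ N - s) + Real.pi * Complex.I := by
    rw [← neg_sub, Complex.log, Complex.log, norm_neg, Complex.arg_neg_eq_arg_add_pi_of_im_neg]
    · push_cast; ring
    · rw [Complex.sub_im, contour_im]; simpa using hN0
  have l2 : Complex.log (s - contour γ κ (-N)) =
      Complex.log (contour γ κ (-N) - s) - Real.pi * Complex.I := by
    rw [← neg_sub, Complex.log, Complex.log, norm_neg, Complex.arg_neg_eq_arg_sub_pi_of_im_pos]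
    · push_cast; ring
    · rw [Complex.sub_im, contour_im]; simpa using hN0
  rw [l1, l2]; ring

lemma continuousOn_contourDeriv (γ : ℝ) : ContinuousOn (contourDeriv γ) {0}ᶜ := by
  intro u hu
  refine ContinuousAt.continuousWithinAt ?_
  rcases lt_or_gt_of_ne (show u ≠ 0 from hu) with h | h
  · refine (continuousAt_const (y := contourDeriv γ (-1))).congr ?_
    filter_upwards [eventually_lt_nhds h] with v hv
    simp only [contourDeriv]
    rw [Real.sign_of_neg hv, Real.sign_of_neg (by norm_num)]
  · refine (continuousAt_const (y := contourDeriv γ 1)).congr ?_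
    filter_upwards [eventually_gt_nhds h] with v hv
    simp only [contourDeriv]
    rw [Real.sign_of_pos hv, Real.sign_of_pos (by norm_num)]

end Cauchy

section Heat

variable {H : Type*} [NormedAddCommGroup H] [InnerProductSpace ℂ H] [CompleteSpace H]
  {T : H →ₗ.[ℂ] H} {γ κ t : ℝ}

/-- The heat operator as a contour integral of the resolvent. -/
lemma SelfAdjointGE.heat_eq (hT : SelfAdjointGE T 0) (ht : 0 < t) (hγ : 0 < γ) (hκ : 0 < κ) :
    heat T t = (2 * (Real.pi : ℂ) * Complex.I)⁻¹ • ∫ u : ℝ, contourDeriv γ u •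
      (Complex.exp (-(t * contour γ κ u)) • resolventOp T (contour γ κ u)) := by
  have hn := hT.isStarNormal
  -- the resolvent function `(z - s)⁻¹` in terms of the spectral value `w = (s + i)⁻¹`
  set F : ℝ → ℂ → ℂ := fun u w => contourDeriv γ u * (Complex.exp (-(t * contour γ κ u)) *
    (w * ((contour γ κ u + Complex.I) * w - 1)⁻¹)) with hF
  have hw : ∀ w ∈ spectrum ℂ (cayleyRes T), ∀ u : ℝ, w ≠ 0 → ∃ s : ℝ, 0 ≤ s ∧
      w⁻¹ - Complex.I = s ∧
      w * ((contour γ κ u + Complex.I) * w - 1)⁻¹ = (contour γ κ u - s)⁻¹ := by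
    intro w hw u h0
    obtain ⟨s, hs, e⟩ := hT.exists_of_mem_spectrum hw h0
    refine ⟨s, hs, e, ?_⟩
    have h1 : (contour γ κ u + Complex.I) * w - 1 = w * (contour γ κ u - s) := by
      rw [← e]; field_simp; ring
    rw [h1, mul_inv, ← mul_assoc, mul_inv_cancel₀ h0, one_mul]
  have hden : ∀ w ∈ spectrum ℂ (cayleyRes T), ∀ u : ℝ,
      (contour γ κ u + Complex.I) * w - 1 ≠ 0 := by
    intro w hw' u hcon
    by_cases h0 : w = 0
    · rw [h0] at hcon; simp at hcon
    · obtain ⟨s, hs, -, h1⟩ := hw w hw' u h0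
      rw [hcon, inv_zero, mul_zero] at h1
      exact (inv_ne_zero (sub_ne_zero.2 (contour_mem_cutPlane hκ u s hs))) h1.symm
  have hcont : ContinuousOn (Function.uncurry F) ({0}ᶜ ×ˢ spectrum ℂ (cayleyRes T)) := by
    have h1 : ContinuousOn (fun p : ℝ × ℂ => contourDeriv γ p.1)
        ({0}ᶜ ×ˢ spectrum ℂ (cayleyRes T)) :=
      (continuousOn_contourDeriv γ).comp continuousOn_fst fun p hp => hp.1
    have h2 : Continuous fun p : ℝ × ℂ => contour γ κ p.1 :=
      (continuous_contour γ κ).comp continuous_fst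
    refine h1.mul (ContinuousOn.mul (by fun_prop) (continuousOn_snd.mul ?_))
    exact ContinuousOn.inv₀ (by fun_prop) fun p hp => hden p.2 hp.2 p.1
  have hbound : ∀ u : ℝ, ∀ w ∈ spectrum ℂ (cayleyRes T), ‖F u w‖ ≤
      √(1 + γ ^ 2) * (√(1 + γ ^ 2) / κ * Real.exp (t * κ)) * Real.exp (-(t * γ * |u|)) := by
    intro u w hw'
    refine norm_contourDeriv_smul_le
      (f := fun z => Complex.exp (-(t * z)) * (w * ((z + Complex.I) * w - 1)⁻¹)) ?_
    rw [norm_mul, norm_exp_neg_mul, mul_comm]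
    gcongr
    by_cases h0 : w = 0
    · rw [h0, zero_mul, norm_zero]; positivity
    · obtain ⟨s, hs, -, h1⟩ := hw w hw' u h0
      rw [h1]
      refine (norm_inv_sub_le γ hκ ?_ hs).trans ?_
      · rw [contour_re, contour_im, abs_neg]
      · gcongr; linarith
  -- the functional calculus commutes with the integral; `u = 0` is left out, since the integrand
  -- is not continuous there
  have key := cfc_setIntegral (μ := MeasureTheory.volume) (s := {(0 : ℝ)}ᶜ)
    (MeasurableSet.singleton 0).compl F _ (cayleyRes T) hcont
    (Eventually.of_forall hbound) (((integrable_exp_neg_abs (mul_pos ht hγ)).const_mul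
      _).restrict.hasFiniteIntegral) hn
  rw [MeasureTheory.restrict_compl_singleton] at key
  have h1 : ∀ u : ℝ, cfc (F u) (cayleyRes T) = contourDeriv γ u •
      (Complex.exp (-(t * contour γ κ u)) • resolventOp T (contour γ κ u)) := by
    intro u
    rw [smul_smul, hT.resolventOp_eq (contour_mem_cutPlane hκ u),
      hT.opFun_smul _ (Admissible.inv_sub 0 (contour_mem_cutPlane hκ u))]
    refine cfc_congr fun w hw' => ?_
    simp only [calcFun, hF]
    split_ifs with h0
    · rw [h0]; ring
    · obtain ⟨s, hs, e, h1⟩ := hw w hw' u h0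
      rw [h1, e, Complex.ofReal_re]; ring
  simp only [h1] at key
  rw [← key, heat, funcCalc_eq, opFun]
  have hpi : (2 * (Real.pi : ℂ) * Complex.I) ≠ 0 := by
    simp [Real.pi_ne_zero]
  have hci : ContinuousOn (fun w => ∫ u : ℝ, F u w) (spectrum ℂ (cayleyRes T)) := by
    refine MeasureTheory.continuousOn_of_dominated
      (bound := fun u => √(1 + γ ^ 2) * (√(1 + γ ^ 2) / κ * Real.exp (t * κ)) *
        Real.exp (-(t * γ * |u|))) ?_ ?_ ?_ ?_
    · intro w hw'
      refine (measurable_contourDeriv γ).aestronglyMeasurable.mul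
        (Continuous.aestronglyMeasurable ?_)
      have h2 := continuous_contour γ κ
      exact Continuous.mul (by fun_prop)
        (continuous_const.mul (Continuous.inv₀ (by fun_prop) (hden w hw')))
    · exact fun w hw' => Eventually.of_forall fun u => hbound u w hw'
    · exact (integrable_exp_neg_abs (mul_pos ht hγ)).const_mul _
    · refine Eventually.of_forall fun u => ?_
      exact continuousOn_const.mul (continuousOn_const.mul
        (continuousOn_id.mul (ContinuousOn.inv₀ (by fun_prop) fun w hw' => hden w hw' u)))
  rw [← cfc_smul _ _ _ hci]
  refine cfc_congr fun w hw' => ?_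
  simp only [calcFun, smul_eq_mul]
  split_ifs with h0
  · simp [hF, h0]
  · obtain ⟨s, hs, e, -⟩ := hw w hw' 0 h0
    have h2 : ∀ u : ℝ, F u w = contourDeriv γ u •
        (Complex.exp (-(t * contour γ κ u)) * (contour γ κ u - s)⁻¹) := by
      intro u
      obtain ⟨s', hs', e', h1⟩ := hw w hw' u h0
      have : s' = s := by exact_mod_cast e'.symm.trans e
      rw [hF, ← this, ← h1]; rfl
    simp only [h2]
    rw [integral_contour_exp ht hγ hκ hs, e, Complex.ofReal_re, ← mul_assoc,
      inv_mul_cancel₀ hpi, one_mul]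

end Heat

/-! ### Factorization of bounded hermitian forms -/

section Factor

variable {H : Type*} [NormedAddCommGroup H] [InnerProductSpace ℂ H]

/-- A hermitian form that is bounded on the diagonal by the square of a seminorm `‖K x‖` satisfies
the corresponding Cauchy–Schwarz inequality. -/
lemma norm_form_le {K : H →L[ℂ] H} {β : H →ₗ⋆[ℂ] H →ₗ[ℂ] ℂ} {lam : ℝ} (hlam : 0 ≤ lam)
    (hβ : ∀ x y, β x y = (starRingEnd ℂ) (β y x)) (hb : ∀ x, ‖β x x‖ ≤ lam * ‖K x‖ ^ 2)
    (x y : H) : ‖β x y‖ ≤ lam * (‖K x‖ * ‖K y‖) := by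
  -- polarization
  have h1 : ∀ x y : H, (β x y).re ≤ lam / 2 * (‖K x‖ ^ 2 + ‖K y‖ ^ 2) := by
    intro x y
    have e : β (x + y) (x + y) - β (x - y) (x - y) = 2 * (β x y + β y x) := by
      simp only [map_add, map_sub, LinearMap.add_apply, LinearMap.sub_apply]; ring
    have e2 := congrArg Complex.re e
    have e3 : (β y x).re = (β x y).re := by rw [hβ x y, Complex.conj_re]
    simp only [Complex.sub_re, Complex.add_re, Complex.mul_re, Complex.re_ofNat, Complex.im_ofNat,
      e3, zero_mul, sub_zero] at e2
    have p1 := (Complex.re_le_norm _).trans (hb (x + y))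
    have p2 := (neg_le_of_abs_le (Complex.abs_re_le_norm (β (x - y) (x - y)))).trans' (neg_le_neg
      (hb (x - y)))
    have p3 := parallelogram_law_with_norm ℂ (K x) (K y)
    rw [ContinuousLinearMap.map_add] at p1
    rw [ContinuousLinearMap.map_sub] at p2
    nlinarith
  -- scaling `x` by `r` and `y` by `r⁻¹`
  have h2 : ∀ x y : H, (β x y).re ≤ lam * (‖K x‖ * ‖K y‖) := by
    intro x y
    have h3 : ∀ ε : ℝ, 0 < ε → (β x y).re ≤ lam * ((‖K x‖ + ε) * (‖K y‖ + ε)) := by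
      intro ε hε
      set p := ‖K x‖ + ε with hp
      set q := ‖K y‖ + ε with hq
      have hp0 : 0 < p := by positivity
      have hq0 : 0 < q := by positivity
      have hpx : ‖K x‖ ≤ p := by linarith
      have hqy : ‖K y‖ ≤ q := by linarith
      set r := √(q / p) with hr
      have hr0 : 0 < r := Real.sqrt_pos.2 (by positivity)
      have hr2 : r ^ 2 = q / p := Real.sq_sqrt (by positivity)
      have := h1 ((r : ℂ) • x) (((r⁻¹ : ℝ) : ℂ) • y)
      simp only [map_smulₛₗ, LinearMap.smul_apply, smul_eq_mul, Complex.conj_ofReal,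
        norm_smul, RingHom.id_apply, Complex.norm_real, Real.norm_eq_abs, abs_of_pos hr0,
        abs_of_pos (inv_pos.2 hr0)] at this
      rw [← mul_assoc, ← Complex.ofReal_mul, inv_mul_cancel₀ hr0.ne', Complex.ofReal_one,
        one_mul] at this
      refine this.trans ?_
      have e1 : (r * ‖K x‖) ^ 2 ≤ p * q := by
        rw [mul_pow, hr2]
        calc q / p * ‖K x‖ ^ 2 ≤ q / p * p ^ 2 := by gcongr
          _ = p * q := by field_simp
      have e2 : (r⁻¹ * ‖K y‖) ^ 2 ≤ p * q := by
        rw [mul_pow, inv_pow, hr2]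
        calc (q / p)⁻¹ * ‖K y‖ ^ 2 ≤ (q / p)⁻¹ * q ^ 2 := by gcongr
          _ = p * q := by field_simp
      nlinarith
    have hlim : Tendsto (fun ε : ℝ => lam * ((‖K x‖ + ε) * (‖K y‖ + ε))) (𝓝[>] 0)
        (𝓝 (lam * ((‖K x‖ + 0) * (‖K y‖ + 0)))) := by
      refine Tendsto.mono_left ?_ nhdsWithin_le_nhds
      exact Continuous.tendsto (by fun_prop) 0
    rw [add_zero, add_zero] at hlim
    exact ge_of_tendsto hlim (by filter_upwards [self_mem_nhdsWithin] with ε hε using h3 ε hε)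
  rcases eq_or_ne (β x y) 0 with h0 | h0
  · rw [h0, norm_zero]; positivity
  -- rotate `x` so that the form becomes real
  have hn : (‖β x y‖ : ℂ) ≠ 0 := by simpa using h0
  have := h2 ((β x y / ‖β x y‖) • x) y
  simp only [map_smulₛₗ, LinearMap.smul_apply, smul_eq_mul, norm_smul, norm_div, RingHom.id_apply,
    Complex.norm_real, norm_norm, map_div₀, Complex.conj_ofReal] at this
  rw [div_self (norm_ne_zero_iff.2 h0), one_mul, div_mul_eq_mul_div, mul_comm, Complex.mul_conj,
    Complex.normSq_eq_norm_sq] at this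
  have e : (((‖β x y‖ ^ 2 : ℝ) : ℂ) / (‖β x y‖ : ℂ)) = (‖β x y‖ : ℂ) := by
    push_cast; field_simp
  rw [e, Complex.ofReal_re] at this
  exact this

variable [CompleteSpace H]

/-- A bounded operator `M` with `|⟨M x|y⟩| ≤ λ ‖K x‖ ‖K y‖` factors through `K` on both sides, with a
middle factor of norm at most `λ`. -/
lemma exists_factor {K M : H →L[ℂ] H} {lam : ℝ} (hlam : 0 ≤ lam)
    (hM : ∀ x y, ‖⟪M x, y⟫_ℂ‖ ≤ lam * (‖K x‖ * ‖K y‖)) :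
    ∃ C : H →L[ℂ] H, ‖C‖ ≤ lam ∧ ∀ x y, ⟪M x, y⟫_ℂ = ⟪K x, C (K y)⟫_ℂ := by
  -- the closure of the range of `K`, in which `K` has dense range
  set V : Submodule ℂ H := (LinearMap.range (K : H →ₗ[ℂ] H)).topologicalClosure with hV
  have : CompleteSpace V := (Submodule.isClosed_topologicalClosure _).completeSpace_coe
  let e : H →ₗ[ℂ] V := (K : H →ₗ[ℂ] H).codRestrict V fun x =>
    Submodule.le_topologicalClosure _ ⟨x, rfl⟩
  have he : ∀ x, ((e x : V) : H) = K x := fun x => rfl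
  have hen : ∀ x, ‖e x‖ = ‖K x‖ := fun x => rfl
  have hd : DenseRange e := by
    rw [DenseRange, Subtype.dense_iff]
    intro v hv
    have h1 : ((↑) '' Set.range e : Set H) = (LinearMap.range (K : H →ₗ[ℂ] H) : Set H) := by
      ext w; simp [he]
    have h2 : v ∈ closure (LinearMap.range (K : H →ₗ[ℂ] H) : Set H) := hv
    rw [← h1] at h2
    exact h2
  have hMn : ∀ x, ‖(M : H →ₗ[ℂ] H) x‖ ≤ (lam * ‖K‖) * ‖e x‖ := by
    intro x
    have h1 := hM x (M x)
    rw [inner_self_eq_ofReal, Complex.norm_real, Real.norm_of_nonneg (by positivity)] at h1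
    change ‖M x‖ ≤ _
    rcases (norm_nonneg (M x)).eq_or_lt with h0 | h0
    · rw [← h0]; positivity
    · have h2 := K.le_opNorm (M x)
      have h3 : ‖M x‖ * ‖M x‖ ≤ (lam * ‖K‖ * ‖K x‖) * ‖M x‖ := by
        calc _ = ‖M x‖ ^ 2 := by ring
          _ ≤ lam * (‖K x‖ * (‖K‖ * ‖M x‖)) := h1.trans (by gcongr)
          _ = _ := by ring
      exact le_of_mul_le_mul_right h3 h0
  -- extend `M` from the range of `K`, and then its adjoint
  let L : V →L[ℂ] H := LinearMap.extendOfNorm (M : H →ₗ[ℂ] H) e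
  have hL : ∀ x, L (e x) = M x := LinearMap.extendOfNorm_eq hd ⟨_, hMn⟩
  have hLb : ∀ v y, ‖⟪L v, y⟫_ℂ‖ ≤ lam * (‖v‖ * ‖K y‖) := by
    intro v y
    refine hd.induction_on (p := fun v => ‖⟪L v, y⟫_ℂ‖ ≤ lam * (‖v‖ * ‖K y‖)) v ?_ fun x => ?_
    · exact isClosed_le (by fun_prop) (by fun_prop)
    · rw [hL, hen]; exact hM x y
  let L' : H →L[ℂ] V := ContinuousLinearMap.adjoint L
  have hL' : ∀ v y, ⟪L v, y⟫_ℂ = ⟪v, L' y⟫_ℂ := fun v y =>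
    (ContinuousLinearMap.adjoint_inner_right L v y).symm
  have hLn : ∀ y, ‖(L' : H →ₗ[ℂ] V) y‖ ≤ lam * ‖e y‖ := by
    intro y
    have h1 := hLb (L' y) y
    rw [hL', inner_self_eq_ofReal, Complex.norm_real, Real.norm_of_nonneg (by positivity)] at h1
    change ‖L' y‖ ≤ _
    rcases (norm_nonneg (L' y)).eq_or_lt with h0 | h0
    · rw [← h0]; positivity
    · have h3 : ‖L' y‖ * ‖L' y‖ ≤ (lam * ‖e y‖) * ‖L' y‖ := by
        calc _ = ‖L' y‖ ^ 2 := by ring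
          _ ≤ lam * (‖L' y‖ * ‖K y‖) := h1
          _ = _ := by rw [hen]; ring
      exact le_of_mul_le_mul_right h3 h0
  let N : V →L[ℂ] V := LinearMap.extendOfNorm (L' : H →ₗ[ℂ] V) e
  have hN : ∀ x, N (e x) = L' x := LinearMap.extendOfNorm_eq hd ⟨_, hLn⟩
  have hNn : ‖N‖ ≤ lam := LinearMap.opNorm_extendOfNorm_le hd hlam hLn
  refine ⟨V.subtypeL ∘L N ∘L V.orthogonalProjectionOnto, ?_, fun x y => ?_⟩
  · refine ContinuousLinearMap.opNorm_le_bound _ hlam fun x => ?_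
    change ‖N (V.orthogonalProjectionOnto x)‖ ≤ _
    calc _ ≤ ‖N‖ * ‖V.orthogonalProjectionOnto x‖ := N.le_opNorm _
      _ ≤ lam * ‖x‖ := by
        gcongr
        exact V.norm_orthogonalProjectionOnto_apply_le x
  · have h1 : V.orthogonalProjectionOnto (K y) = e y :=
      V.orthogonalProjectionOnto_mem_subspace_eq_self (e y)
    change _ = ⟪K x, ((N (V.orthogonalProjectionOnto (K y)) : V) : H)⟫_ℂ
    rw [h1, hN, ← hL, hL']
    rfl

/-- A hermitian form with `|β(x, x)| ≤ λ ‖K x‖²` is of the form `⟨K x|C K y⟩` with a self-adjoint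
operator `C` of norm at most `λ`. -/
lemma exists_isSelfAdjoint_factor {K : H →L[ℂ] H} {β : H →ₗ⋆[ℂ] H →ₗ[ℂ] ℂ} {lam : ℝ}
    (hlam : 0 ≤ lam)
    (hβ : ∀ x y, β x y = (starRingEnd ℂ) (β y x)) (hb : ∀ x, ‖β x x‖ ≤ lam * ‖K x‖ ^ 2) :
    ∃ C : H →L[ℂ] H, IsSelfAdjoint C ∧ ‖C‖ ≤ lam ∧ ∀ x y, β x y = ⟪K x, C (K y)⟫_ℂ := by
  have h1 := norm_form_le hlam hβ hb
  have h2 : ∀ x y, ‖β x y‖ ≤ (lam * (‖K‖ * ‖K‖)) * ‖x‖ * ‖y‖ := by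
    intro x y
    calc _ ≤ lam * (‖K x‖ * ‖K y‖) := h1 x y
      _ ≤ lam * ((‖K‖ * ‖x‖) * (‖K‖ * ‖y‖)) := by
        gcongr <;> exact K.le_opNorm _
      _ = _ := by ring
  let β' : H →L⋆[ℂ] H →L[ℂ] ℂ := β.mkContinuous₂ _ h2
  let M : H →L[ℂ] H := InnerProductSpace.continuousLinearMapOfBilin β'
  have hM : ∀ x y, ⟪M x, y⟫_ℂ = β x y := fun x y =>
    InnerProductSpace.continuousLinearMapOfBilin_apply β' x y
  obtain ⟨C, hC, hCM⟩ := exists_factor (M := M) (K := K) hlam fun x y => by rw [hM]; exact h1 x y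
  refine ⟨(2⁻¹ : ℂ) • (C + star C), ?_, ?_, fun x y => ?_⟩
  · rw [isSelfAdjoint_iff, star_smul, star_add, star_star, add_comm]
    congr 1
    simp
  · have h3 := norm_add_le C (star C)
    have h4 : ‖(2⁻¹ : ℂ)‖ = 2⁻¹ := by simp
    rw [norm_star] at h3
    rw [norm_smul, h4]
    linarith
  · have e1 : β x y = ⟪K x, C (K y)⟫_ℂ := by rw [← hM, hCM]
    have e2 : β x y = ⟪K x, star C (K y)⟫_ℂ := by
      rw [hβ, ← hM, hCM, inner_conj_symm, ContinuousLinearMap.star_eq_adjoint,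
        ContinuousLinearMap.adjoint_inner_right]
    have e3 : ((2⁻¹ : ℂ) • (C + star C)) (K y) = (2⁻¹ : ℂ) • (C (K y) + star C (K y)) := rfl
    rw [e3, inner_smul_right, inner_add_right, ← e1, ← e2]
    ring

end Factor

/-! ### The form sum and its resolvent -/

section FormSum

variable {H : Type*} [NormedAddCommGroup H] [InnerProductSpace ℂ H] [CompleteSpace H]
  {A T K : H →ₗ.[ℂ] H} {C : H →L[ℂ] H} {a : ℝ} {z : ℂ}

/-- `(φ, η)` is in the graph of the operator associated with the form `⟨√T ψ|(1 + C) √T φ⟩`. -/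
def FormGraph (T : H →ₗ.[ℂ] H) (C : H →L[ℂ] H) (φ η : H) : Prop :=
  ∃ h : φ ∈ formDomain T, ∀ ψ : formDomain T,
    ⟪sqrtOp T ψ, sqrtOp T ⟨φ, h⟩ + C (sqrtOp T ⟨φ, h⟩)⟫_ℂ = ⟪(ψ : H), η⟫_ℂ

/-- `K` is the operator associated with the form `⟨√T φ|(1 + C) √T ψ⟩`. -/
def IsFormOp (T : H →ₗ.[ℂ] H) (C : H →L[ℂ] H) (K : H →ₗ.[ℂ] H) : Prop :=
  ∀ φ η : H, (φ, η) ∈ K.graph ↔ FormGraph T C φ η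

lemma IsFormOp.mem_formDomain (hK : IsFormOp T C K) (x : K.domain) : (x : H) ∈ formDomain T :=
  ((hK _ _).1 (LinearPMap.mem_graph K x)).1

lemma IsFormOp.inner_eq (hK : IsFormOp T C K) (x : K.domain) (ψ : formDomain T) :
    ⟪sqrtOp T ψ, sqrtOp T ⟨x, hK.mem_formDomain x⟩ + C (sqrtOp T ⟨x, hK.mem_formDomain x⟩)⟫_ℂ =
      ⟪(ψ : H), K x⟫_ℂ :=
  ((hK _ _).1 (LinearPMap.mem_graph K x)).2 ψ

/-- The solution of `(z - K) φ = y` is `φ = P y + Q W C Q y`, where `P = (z - T)⁻¹`, `Q = √T P` and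
`W` is a right inverse of `1 - C T P`. -/
lemma formGraph_resolvent (hT : SelfAdjointGE T 0) (hz : z ∈ cutPlane) {W : H →L[ℂ] H}
    (hW : (1 - C * boundedProduct T (resolventOp T z)) * W = 1) (y : H) :
    FormGraph T C
      ((resolventOp T z + boundedProduct (sqrtOp T) (resolventOp T z) * W * C *
        boundedProduct (sqrtOp T) (resolventOp T z)) y)
      (z • (resolventOp T z + boundedProduct (sqrtOp T) (resolventOp T z) * W * C *
        boundedProduct (sqrtOp T) (resolventOp T z)) y - y) := by
  have hP := hT.isBoundedProduct_sqrtOp_resolventOp hz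
  have hTP := hT.isBoundedProduct_resolventOp hz
  rw [hTP.boundedProduct_eq] at hW
  rw [hP.boundedProduct_eq]
  have hQ : IsBoundedProduct (sqrtOp T) (opFun T 0 fun s => √s * (z - s)⁻¹)
      (opFun T (-1) fun s => s * (z - s)⁻¹) := by
    have e : ∀ s : ℝ, 0 ≤ s → (√s : ℂ) * (√s * (z - s)⁻¹) = s * (z - s)⁻¹ := fun s hs => by
      rw [← mul_assoc, ← Complex.ofReal_mul, Real.mul_self_sqrt hs]
    have h1 := (Admissible.mul_inv_sub 0 hz).congr e
    have := hT.isBoundedProduct_sqrtOp (Admissible.sqrt_mul_inv_sub 0 hz).1 h1.2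
    rwa [hT.opFun_congr e] at this
  set P := resolventOp T z
  set Q := opFun T 0 fun s => √s * (z - s)⁻¹
  set Z := opFun T (-1) fun s => s * (z - s)⁻¹
  have hZ : ∀ x, Z x = z • P x - x := fun x => by
    obtain ⟨h, e⟩ := hTP x
    rw [← e, (hT.isResolventAt hz).map_apply]
  set v := W (C (Q y)) with hv
  have hWv : v - C (Z v) = C (Q y) := congrArg (fun X : H →L[ℂ] H => X (C (Q y))) hW
  change FormGraph T C (P y + Q v) (z • (P y + Q v) - y)
  obtain ⟨p1, e1⟩ := hP y
  obtain ⟨p2, e2⟩ := hQ v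
  obtain ⟨p3, e3⟩ := hQ y
  obtain ⟨p4, e4⟩ := hP v
  refine ⟨Submodule.add_mem _ p1 p2, fun ψ => ?_⟩
  have hS : sqrtOp T ⟨P y + Q v, Submodule.add_mem _ p1 p2⟩ = Q y + Z v := by
    rw [← e1, ← e2, ← LinearPMap.map_add]; rfl
  have h1 : Q y + Z v + C (Q y + Z v) = Q y + z • P v := by
    rw [map_add, ← hWv, hZ v]; abel
  rw [hS, h1, inner_add_right, inner_smul_right]
  have h2 := hT.inner_sqrtOp ψ ⟨Q y, p3⟩
  have h3 := hT.inner_sqrtOp ψ ⟨P v, p4⟩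
  rw [e3] at h2
  rw [e4] at h3
  simp only at h2 h3
  rw [h2, h3, ← inner_smul_right, ← inner_add_right, hZ y]
  congr 1
  module

lemma norm_opFun_mul_inv_sub_le (hT : SelfAdjointGE T 0) {γ κ : ℝ} (hκ : 0 < κ)
    (hz : z.re ≤ -κ + γ * |z.im|) :
    ‖opFun T (-1) fun s => s * (z - s)⁻¹‖ ≤ √(1 + γ ^ 2) := by
  have h1 : 1 ≤ √(1 + γ ^ 2) := Real.one_le_sqrt.2 (by nlinarith [sq_nonneg γ])
  refine hT.norm_opFun_le (by positivity) (by simpa using h1) fun s hs => ?_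
  rw [norm_mul, Complex.norm_real, Real.norm_of_nonneg hs]
  calc s * ‖(z - s)⁻¹‖ ≤ s * (√(1 + γ ^ 2) / (s + κ)) := by
        gcongr; exact norm_inv_sub_le γ hκ hz hs
    _ = √(1 + γ ^ 2) * (s / (s + κ)) := by ring
    _ ≤ √(1 + γ ^ 2) := by
      refine mul_le_of_le_one_right (by positivity) ((div_le_one (by linarith)).2 (by linarith))

/-- The operator associated with the form is self-adjoint and nonnegative. -/
lemma IsFormOp.selfAdjointGE (hT : SelfAdjointGE T 0) (hK : IsFormOp T C K) (hC : ‖C‖ < 1)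
    (hsymm : ∀ φ ψ : formDomain T,
      ⟪sqrtOp T φ, C (sqrtOp T ψ)⟫_ℂ = ⟪C (sqrtOp T φ), sqrtOp T ψ⟫_ℂ) :
    SelfAdjointGE K 0 := by
  have hlb : LowerBound K 0 := by
    intro x
    rw [← hK.inner_eq x ⟨x, hK.mem_formDomain x⟩, zero_mul, inner_add_right, inner_self_eq_ofReal,
      Complex.add_re, Complex.ofReal_re]
    set u := sqrtOp T ⟨x, hK.mem_formDomain x⟩
    have h1 : ‖⟪u, C u⟫_ℂ‖ ≤ ‖u‖ ^ 2 := by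
      calc _ ≤ ‖u‖ * ‖C u‖ := norm_inner_le_norm _ _
        _ ≤ ‖u‖ * (1 * ‖u‖) := by
          gcongr
          exact (C.le_opNorm u).trans (by gcongr)
        _ = _ := by ring
    have h2 := neg_le_of_abs_le ((Complex.abs_re_le_norm _).trans h1)
    linarith
  refine ⟨isSelfAdjoint_of_surjective (z := -1) (fun x y => ?_) (by norm_num) hlb fun y => ?_, hlb⟩
  · have h1 := hK.inner_eq y ⟨x, hK.mem_formDomain x⟩
    have h2 := congrArg (starRingEnd ℂ) (hK.inner_eq x ⟨y, hK.mem_formDomain y⟩)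
    rw [inner_conj_symm, inner_conj_symm] at h2
    rw [← h1, ← h2, inner_add_left, inner_add_right, hsymm]
  · have hz : ((-1 : ℝ) : ℂ) ∈ cutPlane := fun s hs h => by
      have : (-1 : ℝ) = s := by exact_mod_cast h
      linarith
    have hZ := norm_opFun_mul_inv_sub_le hT (z := ((-1 : ℝ) : ℂ)) (γ := 0) (κ := 1) one_pos (by simp)
    have hCZ : ‖C * boundedProduct T (resolventOp T ((-1 : ℝ) : ℂ))‖ < 1 := by
      rw [(hT.isBoundedProduct_resolventOp hz).boundedProduct_eq]
      refine (norm_mul_le _ _).trans_lt ?_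
      refine (mul_le_mul_of_nonneg_left hZ (norm_nonneg _)).trans_lt ?_
      simpa using hC
    have := formGraph_resolvent (C := C) hT hz
      (mul_neg_geom_series _ hCZ) y
    rw [← hK] at this
    obtain ⟨x, h1, h2⟩ := (LinearPMap.mem_graph_iff _).1 this
    refine ⟨x, ?_⟩
    rw [h2, h1]
    simp

lemma IsFormOp.resolventOp_eq (hT : SelfAdjointGE T 0) (hK : IsFormOp T C K)
    (hKs : SelfAdjointGE K 0) (hz : z ∈ cutPlane) {W : H →L[ℂ] H}
    (hW : (1 - C * boundedProduct T (resolventOp T z)) * W = 1) :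
    resolventOp K z = resolventOp T z + boundedProduct (sqrtOp T) (resolventOp T z) * W * C *
        boundedProduct (sqrtOp T) (resolventOp T z) := by
  refine ((hKs.isResolventAt hz).eq_of_right_inverse fun y => ?_).symm
  have := formGraph_resolvent (C := C) hT hz hW y
  rw [← hK] at this
  obtain ⟨⟨x, hx⟩, h1, h2⟩ := (LinearPMap.mem_graph_iff _).1 this
  simp only at h1 h2
  subst h1
  refine ⟨hx, ?_⟩
  rw [h2]
  abel

end FormSum

/-! ### The Dyson expansion -/

section Dyson

variable {H : Type*} [NormedAddCommGroup H] [InnerProductSpace ℂ H] [CompleteSpace H]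
  {T K : H →ₗ.[ℂ] H} {C : H →L[ℂ] H} {γ κ t : ℝ} {n : ℕ} {z : ℂ}

lemma norm_opFun_sqrt_mul_inv_sub_le (hT : SelfAdjointGE T 0) (hκ : 0 < κ)
    (hz : z.re ≤ -κ + γ * |z.im|) :
    ‖opFun T 0 fun s => √s * (z - s)⁻¹‖ ≤ √(1 + γ ^ 2) / √κ := by
  refine hT.norm_opFun_le (by positivity) (by simpa using by positivity) fun s hs => ?_
  rw [norm_mul, Complex.norm_real, Real.norm_of_nonneg (Real.sqrt_nonneg _)]
  have h1 : √s * √κ ≤ s + κ := by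
    have h2 := Real.sq_sqrt hs
    have h3 := Real.sq_sqrt hκ.le
    nlinarith [sq_nonneg (√s - √κ), sq_nonneg (√s + √κ)]
  have hsk : 0 < √κ := Real.sqrt_pos.2 hκ
  calc √s * ‖(z - s)⁻¹‖ ≤ √s * (√(1 + γ ^ 2) / (s + κ)) := by
        gcongr; exact norm_inv_sub_le γ hκ hz hs
    _ = √(1 + γ ^ 2) * (√s / (s + κ)) := by ring
    _ ≤ √(1 + γ ^ 2) * (1 / √κ) := by
        refine mul_le_mul_of_nonneg_left ?_ (Real.sqrt_nonneg _)
        rw [div_le_div_iff₀ (by linarith) hsk, one_mul]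
        exact h1
    _ = _ := by ring

lemma norm_dysonIntegrand_le (hT : SelfAdjointGE T 0) (C : H →L[ℂ] H) (t : ℝ) (hn : 1 ≤ n)
    (hκ : 0 < κ) (hz : z.re ≤ -κ + γ * |z.im|) :
    ‖dysonIntegrand T C t n z‖ ≤
      √(1 + γ ^ 2) ^ (n + 1) / κ * ‖C‖ ^ n * Real.exp (-(t * z.re)) := by
  have hzc := mem_cutPlane_of_re_le hκ hz
  rw [dysonIntegrand, norm_smul, norm_exp_neg_mul, mul_comm,
    (hT.isBoundedProduct_sqrtOp_resolventOp hzc).boundedProduct_eq,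
    (hT.isBoundedProduct_resolventOp hzc).boundedProduct_eq]
  have hQ := norm_opFun_sqrt_mul_inv_sub_le hT hκ hz
  have hZ := norm_opFun_mul_inv_sub_le hT hκ hz
  set Q := opFun T 0 fun s => √s * (z - s)⁻¹
  set Z := opFun T (-1) fun s => s * (z - s)⁻¹
  set g := √(1 + γ ^ 2)
  gcongr
  obtain ⟨m, rfl⟩ : ∃ m, n = m + 1 := ⟨n - 1, by omega⟩
  rw [Nat.add_sub_cancel]
  have hpow : ∀ k, ‖Q * (C * Z) ^ k‖ ≤ g / √κ * (‖C‖ * g) ^ k := by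
    intro k
    induction k with
    | zero => simpa using hQ
    | succ k ih =>
      have h1 : Q * (C * Z) ^ (k + 1) = Q * (C * Z) ^ k * (C * Z) := by rw [pow_succ, mul_assoc]
      have h2 : g / √κ * (‖C‖ * g) ^ (k + 1) = g / √κ * (‖C‖ * g) ^ k * (‖C‖ * g) := by ring
      rw [h1, h2]
      refine (norm_mul_le _ _).trans (mul_le_mul ih ?_ (norm_nonneg _) (by positivity))
      exact (norm_mul_le _ _).trans (by gcongr)
  calc ‖Q * (C * Z) ^ m * C * Q‖ ≤ ‖Q * (C * Z) ^ m‖ * ‖C‖ * ‖Q‖ := norm_mul₃_le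
    _ ≤ (g / √κ * (‖C‖ * g) ^ m) * ‖C‖ * (g / √κ) := by
      have := hpow m
      gcongr
    _ = g ^ (m + 1 + 1) / (√κ * √κ) * ‖C‖ ^ (m + 1) := by
      rw [mul_pow, pow_succ, pow_succ, pow_succ]; field_simp
    _ = _ := by rw [Real.mul_self_sqrt hκ.le]

lemma differentiableAt_resolventOp (hT : SelfAdjointGE T 0) (hz : z ∈ cutPlane) :
    DifferentiableAt ℂ (resolventOp T) z := by
  set R := resolventOp T z with hR
  have h1 : ContinuousAt (fun w : ℂ => (1 : H →L[ℂ] H) + (w - z) • R) z := by fun_prop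
  have h0 : (1 : H →L[ℂ] H) + (z - z) • R = ((1 : (H →L[ℂ] H)ˣ) : H →L[ℂ] H) := by simp
  have hu : ∀ᶠ w in 𝓝 z, IsUnit ((1 : H →L[ℂ] H) + (w - z) • R) := by
    refine h1.eventually ?_
    simp only [h0]
    exact Units.isOpen.mem_nhds (1 : (H →L[ℂ] H)ˣ).isUnit
  -- near `z` the resolvent is given by inverses of units
  have heq : resolventOp T =ᶠ[𝓝 z] fun w => R * Ring.inverse (1 + (w - z) • R) := by
    filter_upwards [hu, isOpen_cutPlane.mem_nhds hz] with w hw hwc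
    have h2 := (hT.isResolventAt hwc).sub_eq (hT.isResolventAt hz)
    have h3 : resolventOp T w * (1 + (w - z) • R) = R := by
      rw [mul_add, mul_one, mul_smul_comm, ← neg_sub z w, neg_smul, ← h2]; abel
    calc resolventOp T w
        = resolventOp T w * ((1 + (w - z) • R) * Ring.inverse (1 + (w - z) • R)) := by
          rw [Ring.mul_inverse_cancel _ hw, mul_one]
      _ = R * Ring.inverse (1 + (w - z) • R) := by rw [← mul_assoc, h3]
  refine DifferentiableAt.congr_of_eventuallyEq ?_ heq
  refine DifferentiableAt.mul (by fun_prop) ?_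
  have h4 : DifferentiableAt ℂ Ring.inverse ((1 : H →L[ℂ] H) + (z - z) • R) := by
    rw [h0]; exact differentiableAt_inverse (1 : (H →L[ℂ] H)ˣ).isUnit
  exact h4.comp z (f := fun w : ℂ => (1 : H →L[ℂ] H) + (w - z) • R) (by fun_prop)

lemma differentiableAt_boundedProduct (hT : SelfAdjointGE T 0) (hz : z ∈ cutPlane) :
    DifferentiableAt ℂ (fun w => boundedProduct T (resolventOp T w)) z := by
  have heq : (fun w => boundedProduct T (resolventOp T w)) =ᶠ[𝓝 z]
      fun w => w • resolventOp T w - 1 := by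
    filter_upwards [isOpen_cutPlane.mem_nhds hz] with w hw
    refine IsBoundedProduct.boundedProduct_eq fun x => ?_
    have h := hT.isResolventAt hw
    exact ⟨h.apply_mem x, h.map_apply x _⟩
  refine DifferentiableAt.congr_of_eventuallyEq ?_ heq
  exact (differentiableAt_id.smul (differentiableAt_resolventOp hT hz)).sub
    (differentiableAt_const _)

lemma differentiableAt_boundedProduct_sqrtOp (hT : SelfAdjointGE T 0) (hz : z ∈ cutPlane) :
    DifferentiableAt ℂ (fun w => boundedProduct (sqrtOp T) (resolventOp T w)) z := by
  have heq : (fun w => boundedProduct (sqrtOp T) (resolventOp T w)) =ᶠ[𝓝 z]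
      fun w => boundedProduct (sqrtOp T) (resolventOp T z) * (1 + (z - w) • resolventOp T w) := by
    filter_upwards [isOpen_cutPlane.mem_nhds hz] with w hw
    have hQ := hT.isBoundedProduct_sqrtOp_resolventOp hz
    rw [hQ.boundedProduct_eq]
    have h2 := (hT.isResolventAt hz).sub_eq (hT.isResolventAt hw)
    have h3 : resolventOp T z * (1 + (z - w) • resolventOp T w) = resolventOp T w := by
      rw [mul_add, mul_one, mul_smul_comm, ← neg_sub w z, neg_smul, ← h2]; abel
    have h4 := hQ.mul_right (1 + (z - w) • resolventOp T w)
    rw [h3] at h4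
    exact h4.boundedProduct_eq
  refine DifferentiableAt.congr_of_eventuallyEq ?_ heq
  refine DifferentiableAt.mul (by fun_prop) (DifferentiableAt.add (by fun_prop) ?_)
  have h : DifferentiableAt ℂ (fun w => z - w) z := by fun_prop
  exact h.smul (differentiableAt_resolventOp hT hz)

lemma differentiableOn_dysonIntegrand (hT : SelfAdjointGE T 0) (C : H →L[ℂ] H) (t : ℝ) (n : ℕ) :
    DifferentiableOn ℂ (dysonIntegrand T C t n) cutPlane := by
  intro z hz
  refine DifferentiableAt.differentiableWithinAt ?_
  have hQ := differentiableAt_boundedProduct_sqrtOp hT hz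
  have hZ := differentiableAt_boundedProduct hT hz
  have hC : DifferentiableAt ℂ (fun _ : ℂ => C) z := differentiableAt_const _
  unfold dysonIntegrand
  have he : DifferentiableAt ℂ (fun w : ℂ => Complex.exp (-(t * w))) z := by fun_prop
  exact he.smul (((hQ.mul ((hC.mul hZ).pow _)).mul hC).mul hQ)

lemma sectorBound_dysonIntegrand (hT : SelfAdjointGE T 0) (C : H →L[ℂ] H) (t : ℝ) (hn : 1 ≤ n) :
    SectorBound (dysonIntegrand T C t n) t := fun _ _ _ hκ =>
  ⟨_, fun _ hz => norm_dysonIntegrand_le hT C t hn hκ hz⟩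

lemma integrable_dysonPullback (hT : SelfAdjointGE T 0) (C : H →L[ℂ] H) (ht : 0 < t) (hγ : 0 < γ)
    (hκ : 0 < κ) (hn : 1 ≤ n) : MeasureTheory.Integrable (dysonPullback T C t γ κ n) :=
  integrable_contour (differentiableOn_dysonIntegrand hT C t n).continuousOn ht
    (sectorBound_dysonIntegrand hT C t hn) hγ hκ

lemma dysonTerm_eq (hT : SelfAdjointGE T 0) (C : H →L[ℂ] H) (ht : 0 < t) (hγ : 0 < γ) (hκ : 0 < κ)
    {γ' κ' : ℝ} (hγ' : 0 < γ') (hκ' : 0 < κ') (hn : 1 ≤ n) :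
    dysonTerm T C t γ κ n = dysonTerm T C t γ' κ' n :=
  congrArg _ (integral_contour_eq (differentiableOn_dysonIntegrand hT C t n) ht
    (sectorBound_dysonIntegrand hT C t hn) hγ hκ hγ' hκ')

/-- The bound of the integrand on the contour. -/
lemma norm_dysonPullback_le (hT : SelfAdjointGE T 0) (C : H →L[ℂ] H) (t : ℝ) (hκ : 0 < κ)
    (hn : 1 ≤ n) (u : ℝ) :
    ‖dysonPullback T C t γ κ n u‖ ≤
      Real.exp (t * κ) / κ * √(1 + γ ^ 2) ^ (n + 2) * ‖C‖ ^ n * Real.exp (-(t * γ * |u|)) := by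
  refine (norm_contourDeriv_smul_le (f := dysonIntegrand T C t n)
    (norm_dysonIntegrand_le hT C t hn hκ (γ := γ) ?_)).trans (le_of_eq ?_)
  · rw [contour_re, contour_im, abs_neg]
  · rw [pow_succ _ (n + 1)]; ring

lemma integral_norm_dysonPullback_le (hT : SelfAdjointGE T 0) (C : H →L[ℂ] H) (ht : 0 < t)
    (hγ : 0 < γ) (hκ : 0 < κ) (hn : 1 ≤ n) :
    ∫ u : ℝ, ‖dysonPullback T C t γ κ n u‖ ≤
      Real.exp (t * κ) / κ * √(1 + γ ^ 2) ^ (n + 2) * ‖C‖ ^ n * (2 / (t * γ)) := by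
  rw [← integral_exp_neg_abs (mul_pos ht hγ), ← MeasureTheory.integral_const_mul]
  exact MeasureTheory.integral_mono (integrable_dysonPullback hT C ht hγ hκ hn).norm
    ((integrable_exp_neg_abs (mul_pos ht hγ)).const_mul _)
    fun u => norm_dysonPullback_le hT C t hκ hn u

/-- The optimal contour has `κ = 1 / t` and `γ = 1 / √(n + 2)`. -/
lemma norm_dysonTerm_le (hT : SelfAdjointGE T 0) (C : H →L[ℂ] H) (ht : 0 < t) (hγ : 0 < γ)
    (hκ : 0 < κ) (hn : 1 ≤ n) :
    ‖dysonTerm T C t γ κ n‖ ≤ Real.exp (3 / 2) / Real.pi * √((n : ℝ) + 2) * ‖C‖ ^ n := by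
  have hN : (0 : ℝ) < n + 2 := by positivity
  set r := √((n : ℝ) + 2) with hr
  have hr0 : 0 < r := Real.sqrt_pos.2 hN
  have hr2 : r ^ 2 = n + 2 := Real.sq_sqrt hN.le
  have hg : 0 < r⁻¹ := inv_pos.2 hr0
  have hk : 0 < t⁻¹ := inv_pos.2 ht
  rw [dysonTerm_eq hT C ht hγ hκ hg hk hn, dysonTerm, norm_smul]
  have h1 := (MeasureTheory.norm_integral_le_integral_norm _).trans
    (integral_norm_dysonPullback_le hT C ht hg hk hn)
  have h2 : √(1 + r⁻¹ ^ 2) ^ (n + 2) ≤ Real.exp (1 / 2) := by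
    have h3 : √(1 + r⁻¹ ^ 2) ≤ Real.exp ((n + 2 : ℝ)⁻¹ / 2) := by
      rw [Real.exp_half, inv_pow, hr2, add_comm]
      exact Real.sqrt_le_sqrt (Real.add_one_le_exp _)
    calc _ ≤ Real.exp ((n + 2 : ℝ)⁻¹ / 2) ^ (n + 2) := by gcongr
      _ = Real.exp (1 / 2) := by
        rw [← Real.exp_nat_mul]; congr 1; push_cast; field_simp
  have h4 : ‖(2 * (Real.pi : ℂ) * Complex.I)⁻¹‖ = (2 * Real.pi)⁻¹ := by
    rw [norm_inv, norm_mul, norm_mul, Complex.norm_I, Complex.norm_real,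
      Real.norm_of_nonneg Real.pi_pos.le]
    simp
  rw [h4]
  calc _ ≤ (2 * Real.pi)⁻¹ * (Real.exp (t * t⁻¹) / t⁻¹ * √(1 + r⁻¹ ^ 2) ^ (n + 2) * ‖C‖ ^ n *
        (2 / (t * r⁻¹))) := by gcongr
    _ ≤ (2 * Real.pi)⁻¹ * (Real.exp (t * t⁻¹) / t⁻¹ * Real.exp (1 / 2) * ‖C‖ ^ n *
        (2 / (t * r⁻¹))) := by gcongr
    _ = _ := by
      have h5 : Real.exp (3 / 2) = Real.exp 1 * Real.exp (1 / 2) := by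
        rw [← Real.exp_add]; norm_num
      have := Real.pi_pos
      rw [mul_inv_cancel₀ ht.ne', h5]
      field_simp

lemma summable_norm_dysonTerm (hT : SelfAdjointGE T 0) (hC : ‖C‖ < 1) (ht : 0 < t) (hγ : 0 < γ)
    (hκ : 0 < κ) : Summable fun n : ℕ => ‖dysonTerm T C t γ κ (n + 1)‖ := by
  have h1 : Summable fun n : ℕ => ((n : ℝ) ^ 1 * ‖C‖ ^ n) :=
    summable_pow_mul_geometric_of_norm_lt_one 1 (by simpa using hC)
  have h2 : Summable fun n : ℕ => ‖C‖ ^ n := summable_geometric_of_lt_one (norm_nonneg _) hC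
  refine Summable.of_nonneg_of_le (fun _ => norm_nonneg _) (fun n => ?_)
    ((h1.add (h2.mul_left 3)).mul_left (Real.exp (3 / 2) / Real.pi))
  refine (norm_dysonTerm_le hT C ht hγ hκ (by omega)).trans ?_
  have h3 : √(((n + 1 : ℕ) : ℝ) + 2) ≤ n + 3 := by
    refine Real.sqrt_le_iff.2 ⟨by positivity, ?_⟩
    push_cast
    have : (0 : ℝ) ≤ n := by positivity
    nlinarith
  have h4 : ‖C‖ ^ (n + 1) ≤ ‖C‖ ^ n := pow_le_pow_of_le_one (norm_nonneg _) hC.le (by omega)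
  have := Real.pi_pos
  calc _ ≤ Real.exp (3 / 2) / Real.pi * (n + 3) * ‖C‖ ^ n := by gcongr
    _ = _ := by ring

/-- On a sufficiently flat contour, the resolvent of the form sum is the sum of a Neumann series. -/
lemma IsFormOp.hasSum_resolventOp (hT : SelfAdjointGE T 0) (hK : IsFormOp T C K)
    (hKs : SelfAdjointGE K 0) (hκ : 0 < κ) (hCγ : ‖C‖ * √(1 + γ ^ 2) < 1)
    (hz : z.re ≤ -κ + γ * |z.im|) (t : ℝ) :
    HasSum (fun n : ℕ => dysonIntegrand T C t (n + 1) z)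
      (Complex.exp (-(t * z)) • (resolventOp K z - resolventOp T z)) := by
  have hzc := mem_cutPlane_of_re_le hκ hz
  have hCZ : ‖C * boundedProduct T (resolventOp T z)‖ < 1 := by
    rw [(hT.isBoundedProduct_resolventOp hzc).boundedProduct_eq]
    refine (norm_mul_le _ _).trans_lt ?_
    refine (mul_le_mul_of_nonneg_left (norm_opFun_mul_inv_sub_le hT hκ hz)
      (norm_nonneg _)).trans_lt hCγ
  rw [hK.resolventOp_eq hT hKs hzc (mul_neg_geom_series _ hCZ), add_sub_cancel_left]
  have h1 := (summable_geometric_of_norm_lt_one hCZ).hasSum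
  exact ((((h1.mul_left _).mul_right C).mul_right _).const_smul _)

/-- The slope of a contour on which the Neumann series of `1 - C T (z - T)⁻¹` converges. -/
lemma exists_contour_slope {c : ℝ} (hc : c < 1) :
    ∃ γ : ℝ, 0 < γ ∧ c * √(1 + γ ^ 2) < 1 := by
  have h : Tendsto (fun γ : ℝ => c * √(1 + γ ^ 2)) (𝓝[>] 0) (𝓝 (c * √(1 + 0 ^ 2))) := by
    refine Tendsto.mono_left ?_ nhdsWithin_le_nhds
    exact Continuous.tendsto (by fun_prop) 0
  have h2 : c * √(1 + 0 ^ 2) < 1 := by simpa using hc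
  obtain ⟨γ, h3, h4⟩ := ((h.eventually_lt_const h2).and self_mem_nhdsWithin).exists
  exact ⟨γ, h4, h3⟩

lemma integrable_resolventOp (hT : SelfAdjointGE T 0) (ht : 0 < t) (hγ : 0 < γ) (hκ : 0 < κ) :
    MeasureTheory.Integrable fun u : ℝ => contourDeriv γ u •
      (Complex.exp (-(t * contour γ κ u)) • resolventOp T (contour γ κ u)) := by
  refine integrable_contour (f := fun z => Complex.exp (-(t * z)) • resolventOp T z) ?_ ht ?_ hγ hκ
  · intro z hz
    refine ContinuousAt.continuousWithinAt ?_
    have he : ContinuousAt (fun w : ℂ => Complex.exp (-(t * w))) z := by fun_prop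
    exact he.smul (differentiableAt_resolventOp hT hz).continuousAt
  · intro γ hγ κ hκ
    refine ⟨√(1 + γ ^ 2) / κ, fun z hz => ?_⟩
    rw [norm_smul, norm_exp_neg_mul, mul_comm,
      hT.resolventOp_eq (mem_cutPlane_of_re_le hκ hz)]
    gcongr
    refine hT.norm_opFun_le (by positivity) (by simpa using by positivity) fun s hs => ?_
    exact (norm_inv_sub_le γ hκ hz hs).trans (by gcongr; linarith)

/-- The Dyson expansion of the heat operator of a form sum. -/
lemma IsFormOp.heat_eq (hT : SelfAdjointGE T 0) (hK : IsFormOp T C K)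
    (hKs : SelfAdjointGE K 0) (hC : ‖C‖ < 1) (ht : 0 < t) (hγ : 0 < γ) (hκ : 0 < κ) :
    heat K t = heat T t + ∑' n : ℕ, dysonTerm T C t γ κ (n + 1) := by
  -- the integrals do not depend on the contour, and on a flat one the series converges
  obtain ⟨γ', hγ', hCγ⟩ := exists_contour_slope hC
  have hterm : ∀ n : ℕ, dysonTerm T C t γ κ (n + 1) = dysonTerm T C t γ' κ (n + 1) := fun n =>
    dysonTerm_eq hT C ht hγ hκ hγ' hκ (by omega)
  simp only [hterm]
  have hsum : Summable fun n : ℕ => ∫ u : ℝ, ‖dysonPullback T C t γ' κ (n + 1) u‖ := by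
    have h1 : Summable fun n : ℕ => (‖C‖ * √(1 + γ' ^ 2)) ^ n :=
      summable_geometric_of_lt_one (by positivity) hCγ
    refine Summable.of_nonneg_of_le
      (fun n => MeasureTheory.integral_nonneg fun u => norm_nonneg _)
      (fun n => integral_norm_dysonPullback_le hT C ht hγ' hκ (by omega)) ?_
    refine (h1.mul_left
      (Real.exp (t * κ) / κ * √(1 + γ' ^ 2) ^ 3 * ‖C‖ * (2 / (t * γ')))).congr fun n => ?_
    rw [mul_pow]; ring
  have h1 := MeasureTheory.hasSum_integral_of_summable_integral_norm
    (fun n => integrable_dysonPullback hT C ht hγ' hκ (n := n + 1) (by omega)) hsum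
  have h2 : ∀ u : ℝ, ∑' n : ℕ, dysonPullback T C t γ' κ (n + 1) u =
      contourDeriv γ' u • (Complex.exp (-(t * contour γ' κ u)) • resolventOp K (contour γ' κ u)) -
      contourDeriv γ' u • (Complex.exp (-(t * contour γ' κ u)) • resolventOp T (contour γ' κ u)) := by
    intro u
    rw [← smul_sub, ← smul_sub]
    refine HasSum.tsum_eq (HasSum.const_smul _ (hK.hasSum_resolventOp hT hKs hκ hCγ ?_ t))
    rw [contour_re, contour_im, abs_neg]
  simp only [h2] at h1
  rw [MeasureTheory.integral_sub (integrable_resolventOp hKs ht hγ' hκ)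
    (integrable_resolventOp hT ht hγ' hκ)] at h1
  have h3 := (h1.const_smul (2 * (Real.pi : ℂ) * Complex.I)⁻¹).tsum_eq
  rw [smul_sub, ← hT.heat_eq ht hγ' hκ, ← hKs.heat_eq ht hγ' hκ] at h3
  have h4 : ∑' n : ℕ, dysonTerm T C t γ' κ (n + 1) = heat K t - heat T t := h3
  rw [h4]
  abel

end Dyson

/-! ### Forms on the form domain of `A` -/

section Forms

variable {H : Type*} [NormedAddCommGroup H] [InnerProductSpace ℂ H] [CompleteSpace H]
  {A : H →ₗ.[ℂ] H} {B : formDomain A →ₗ⋆[ℂ] formDomain A →ₗ[ℂ] ℂ} {C : H →L[ℂ] H} {a : ℝ}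

/-- The form `B` is represented as `√(A + a) C √(A + a)` with a self-adjoint contraction `C`. -/
lemma exists_represents (hA : SelfAdjointGE A 0)
    (hB : ∀ φ ψ : formDomain A, B φ ψ = (starRingEnd ℂ) (B ψ φ)) (ha : 0 ≤ a) {lam : ℝ}
    (hlam : 0 ≤ lam)
    (hBA : ∀ ψ : formDomain A,
      ‖B ψ ψ‖ ≤ lam * ((energyForm A ψ ψ).re + a * ‖(ψ : H)‖ ^ 2)) :
    ∃ C : H →L[ℂ] H, IsSelfAdjoint C ∧ ‖C‖ ≤ lam ∧ Represents A a B C := by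
  set T := addConst A a with hTdef
  have hT := hA.addConst a
  have hmem : ∀ x, sqrtRes T x ∈ formDomain A := fun x =>
    (mem_formDomain_addConst hA ha).1 (hT.isBoundedProduct_sqrtRes x).1
  let G : H →ₗ[ℂ] formDomain A := (sqrtRes T : H →ₗ[ℂ] H).codRestrict _ hmem
  have hG : ∀ x, ((G x : formDomain A) : H) = sqrtRes T x := fun x => rfl
  -- the form in the variables `x = (1 + √(A + a)) φ`
  let β : H →ₗ⋆[ℂ] H →ₗ[ℂ] ℂ := LinearMap.mk₂'ₛₗ (starRingEnd ℂ) (RingHom.id ℂ)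
    (fun x y => B (G x) (G y)) (by simp) (by simp) (by simp) (by simp)
  have hS : ∀ x (h : sqrtRes T x ∈ formDomain T), sqrtOp T ⟨sqrtRes T x, h⟩ =
      (1 - sqrtRes T) x := fun x h => (hT.isBoundedProduct_sqrtRes x).2
  obtain ⟨C, h1, h2, h3⟩ := exists_isSelfAdjoint_factor (K := 1 - sqrtRes T) (β := β) hlam
    (fun x y => hB _ _) fun x => by
      refine (hBA (G x)).trans (le_of_eq ?_)
      have h4 := (hT.isBoundedProduct_sqrtRes x).1
      have h5 := inner_sqrtOp_addConst hA ha (G x) (G x) h4 h4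
      have h6 : sqrtOp (addConst A a) ⟨(G x : formDomain A), h4⟩ = (1 - sqrtRes T) x := hS x h4
      rw [h6, inner_self_eq_ofReal, inner_self_eq_ofReal] at h5
      have h7 := congrArg Complex.re h5
      rw [Complex.add_re, ← Complex.ofReal_mul, Complex.ofReal_re, Complex.ofReal_re] at h7
      rw [h7]
  refine ⟨C, h1, h2, fun φ ψ => ?_⟩
  have hφ := (mem_formDomain_addConst hA ha).2 φ.2
  have hψ := (mem_formDomain_addConst hA ha).2 ψ.2
  refine ⟨hφ, hψ, ?_⟩
  obtain ⟨x, hx, e1⟩ := hT.exists_sqrtRes_eq ⟨φ, hφ⟩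
  obtain ⟨y, hy, e2⟩ := hT.exists_sqrtRes_eq ⟨ψ, hψ⟩
  have hx' : G x = φ := Subtype.ext hx
  have hy' : G y = ψ := Subtype.ext hy
  have := h3 x y
  rw [← e1, ← e2] at this
  rw [← this]
  change _ = B (G x) (G y)
  rw [hx', hy']

lemma mem_formSumGraph_iff (hA : SelfAdjointGE A 0) (ha : 0 ≤ a) (hC : Represents A a B C)
    {φ η : H} : (φ, η) ∈ formSumGraph A B ↔ FormGraph (addConst A a) C φ (η + (a : ℂ) • φ) := by
  constructor
  · rintro ⟨h, hg⟩
    have hφ := (mem_formDomain_addConst hA ha).2 h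
    refine ⟨hφ, fun ψ => ?_⟩
    have hψ := (mem_formDomain_addConst hA ha).1 ψ.2
    have h1 := hg ⟨ψ, hψ⟩
    obtain ⟨_, _, h2⟩ := hC ⟨ψ, hψ⟩ ⟨φ, h⟩
    have h3 := inner_sqrtOp_addConst hA ha ⟨ψ, hψ⟩ ⟨φ, h⟩ ψ.2 hφ
    rw [inner_add_right, inner_add_right, inner_smul_right, h3, ← h2, ← h1]
    ring
  · rintro ⟨hφ, hg⟩
    have h := (mem_formDomain_addConst hA ha).1 hφ
    refine ⟨h, fun ψ => ?_⟩
    have hψ := (mem_formDomain_addConst hA ha).2 ψ.2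
    have h1 := hg ⟨ψ, hψ⟩
    obtain ⟨_, _, h2⟩ := hC ψ ⟨φ, h⟩
    have h3 := inner_sqrtOp_addConst hA ha ψ ⟨φ, h⟩ hψ hφ
    rw [inner_add_right, inner_add_right, inner_smul_right, h3, ← h2] at h1
    linear_combination h1

lemma formSum_graph (hA : SelfAdjointGE A 0) : (formSum A B).graph = formSumGraph A B := by
  refine Submodule.toLinearPMap_graph_eq _ ?_
  rintro ⟨x, η⟩ ⟨h, hg⟩ hx
  simp only at h hg hx
  subst hx
  refine hA.dense_formDomain.eq_zero_of_inner_right ℂ fun v hv => ?_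
  rw [← hg ⟨v, hv⟩]
  have e : (⟨0, h⟩ : formDomain A) = 0 := rfl
  simp [energyForm, e]

lemma isFormOp_formSum (hA : SelfAdjointGE A 0) (ha : 0 ≤ a) (hC : Represents A a B C) :
    IsFormOp (addConst A a) C (addConst (formSum A B) a) := by
  intro φ η
  have h1 : (φ, η) ∈ (addConst (formSum A B) a).graph ↔
      (φ, η - (a : ℂ) • φ) ∈ (formSum A B).graph := by
    rw [LinearPMap.mem_graph_iff, LinearPMap.mem_graph_iff]
    constructor
    · rintro ⟨⟨x, hx⟩, h1, h2⟩
      simp only at h1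
      subst h1
      rw [addConst_apply] at h2
      exact ⟨⟨x, hx⟩, rfl, eq_sub_of_add_eq' h2⟩
    · rintro ⟨⟨x, hx⟩, h1, h2⟩
      simp only at h1
      subst h1
      exact ⟨⟨x, hx⟩, rfl, (addConst_apply _ _).trans (add_eq_of_eq_sub' h2)⟩
  rw [h1, formSum_graph hA, mem_formSumGraph_iff hA ha hC, sub_add_cancel]

lemma Represents.inner_eq (hA : SelfAdjointGE A 0) (ha : 0 ≤ a) (hC : Represents A a B C)
    (hB : ∀ φ ψ : formDomain A, B φ ψ = (starRingEnd ℂ) (B ψ φ))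
    (φ ψ : formDomain (addConst A a)) :
    ⟪sqrtOp (addConst A a) φ, C (sqrtOp (addConst A a) ψ)⟫_ℂ =
      ⟪C (sqrtOp (addConst A a) φ), sqrtOp (addConst A a) ψ⟫_ℂ := by
  have hφ := (mem_formDomain_addConst hA ha).1 φ.2
  have hψ := (mem_formDomain_addConst hA ha).1 ψ.2
  obtain ⟨_, _, h1⟩ := hC ⟨φ, hφ⟩ ⟨ψ, hψ⟩
  obtain ⟨_, _, h2⟩ := hC ⟨ψ, hψ⟩ ⟨φ, hφ⟩
  have h3 := hB ⟨φ, hφ⟩ ⟨ψ, hψ⟩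
  rw [h1, h2, inner_conj_symm] at h3
  exact h3

end Forms

end

end FormDyson

theorem mainTheorem3 {H : Type*} [NormedAddCommGroup H] [InnerProductSpace ℂ H] [CompleteSpace H]
    (A : H →ₗ.[ℂ] H) (hA : IsSelfAdjoint A) (hA0 : FormDyson.IsNonneg A)
    (B : FormDyson.formDomain A →ₗ⋆[ℂ] FormDyson.formDomain A →ₗ[ℂ] ℂ)
    (hB : ∀ φ ψ : FormDyson.formDomain A, B φ ψ = (starRingEnd ℂ) (B ψ φ))
    (a : ℝ) (ha : 0 ≤ a) (lam : ℝ) (hlam0 : 0 < lam) (hlam1 : lam < 1)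
    (hBA : ∀ ψ : FormDyson.formDomain A,
      ‖B ψ ψ‖ ≤ lam * ((FormDyson.energyForm A ψ ψ).re + a * ‖(ψ : H)‖ ^ 2)) :
    -- the form sum is a self-adjoint operator bounded from below
    IsSelfAdjoint (FormDyson.formSum A B) ∧
    FormDyson.IsNonneg (FormDyson.addConst (FormDyson.formSum A B) a) ∧
    -- the perturbation has a representation by a contraction
    (∃ C : H →L[ℂ] H, IsSelfAdjoint C ∧ ‖C‖ ≤ lam ∧ FormDyson.Represents A a B C) ∧
    -- the expansion, for every such representation
    ∀ C : H →L[ℂ] H, ‖C‖ < 1 → FormDyson.Represents A a B C →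
      ∀ t : ℝ, 0 < t → ∀ γ : ℝ, 0 < γ → ∀ κ : ℝ, 0 < κ →
        (∀ n : ℕ, 1 ≤ n →
          MeasureTheory.Integrable
            (FormDyson.dysonPullback (FormDyson.addConst A a) C t γ κ n) ∧
          (∀ γ' : ℝ, 0 < γ' → ∀ κ' : ℝ, 0 < κ' →
            FormDyson.dysonTerm (FormDyson.addConst A a) C t γ κ n =
              FormDyson.dysonTerm (FormDyson.addConst A a) C t γ' κ' n) ∧
          ‖FormDyson.dysonTerm (FormDyson.addConst A a) C t γ κ n‖ ≤
            Real.exp (3 / 2) / Real.pi * √((n : ℝ) + 2) * ‖C‖ ^ n) ∧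
        Summable (fun n : ℕ =>
          ‖FormDyson.dysonTerm (FormDyson.addConst A a) C t γ κ (n + 1)‖) ∧
        FormDyson.heat (FormDyson.addConst (FormDyson.formSum A B) a) t =
          FormDyson.heat (FormDyson.addConst A a) t +
            ∑' n : ℕ, FormDyson.dysonTerm (FormDyson.addConst A a) C t γ κ (n + 1) ∧
        FormDyson.heat (FormDyson.formSum A B) t =
          FormDyson.heat A t +
            ∑' n : ℕ, Real.exp (t * a) •
              FormDyson.dysonTerm (FormDyson.addConst A a) C t γ κ (n + 1) := by
  have hA' : FormDyson.SelfAdjointGE A 0 := ⟨hA, hA0.lowerBound⟩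
  have hT : FormDyson.SelfAdjointGE (FormDyson.addConst A a) 0 :=
    (hA'.addConst a).mono (by linarith)
  obtain ⟨C₀, hC₀, hC₀n, hC₀r⟩ := FormDyson.exists_represents hA' hB ha hlam0.le hBA
  have hK : FormDyson.SelfAdjointGE (FormDyson.addConst (FormDyson.formSum A B) a) 0 :=
    (FormDyson.isFormOp_formSum hA' ha hC₀r).selfAdjointGE hT (hC₀n.trans_lt hlam1)
      (hC₀r.inner_eq hA' ha hB)
  have hAB : FormDyson.SelfAdjointGE (FormDyson.formSum A B) (-a) := by
    have := hK.addConst (-a)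
    rwa [FormDyson.addConst_addConst_neg, zero_add] at this
  refine ⟨hAB.isSelfAdjoint, hK.lowerBound.isNonneg, ⟨C₀, hC₀, hC₀n, hC₀r⟩, ?_⟩
  intro C hC hCr t ht γ hγ κ hκ
  have hexp := (FormDyson.isFormOp_formSum hA' ha hCr).heat_eq hT hK hC ht hγ hκ
  have hsum := FormDyson.summable_norm_dysonTerm hT hC ht hγ hκ
  refine ⟨fun n hn => ⟨FormDyson.integrable_dysonPullback hT C ht hγ hκ hn,
    fun γ' hγ' κ' hκ' => FormDyson.dysonTerm_eq hT C ht hγ hκ hγ' hκ' hn,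
    FormDyson.norm_dysonTerm_le hT C ht hγ hκ hn⟩, hsum, hexp, ?_⟩
  rw [hAB.heat_addConst a ht, hA'.heat_addConst a ht, hexp, smul_add,
    hsum.of_norm.tsum_const_smul]
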